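/- Let $\Omega$ and $I$ be sets and let $U$ be a family of subsets of $\bar\Omega=\Omega\times I$, closed under (finite) union and intersection, with $\varnothing,\bar\Omega\in U$, ordered by reverse inclusion: $s\le t$ means $t\subset s$. For $s,t\in U$ let $(s\cap t^c)(i)=\{\omega:(\omega,i)\in s\cap t^c\}$ and $\{s<t\}=\bigcup_{i\in I}(s\cap t^c)(i)$. Let $\bar{\mathbb A}=(\bar{\mathscr A}_u:u\in U)$ be a family of $\sigma$-algebras on $\Omega$, increasing in $u$, such that $F\cap(s\cap t^c)(i)\in\bar{\mathscr A}_s\cap\bar{\mathscr A}_t$ and $F\cap\{s<t\}\in\bar{\mathscr A}_s\cap\bar{\mathscr A}_t$ for all $s,t\in U$, $F\in\bar{\mathscr A}_s$, $i\in I$; let $\mathscr F=\sigma\big(\bigcup_u\bar{\mathscr A}_u\big)$ and let $P$ be a probability measure on $\mathscr F$. Let $\bar{\mathscr D}$ be the set of finite disjoint collections $d$ of sets $u\cap v^c$ with $u\le v$ in $U$, each given with its pair $(u,v)$. It is directed by refinement: $d\le d'$ if each $u\cap v^c\in d$ is a finite union of sets $u_n\cap v_n^c\in d'$ with $u\le u_n$.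 Fix a Banach limit $\mathrm{LIM}_{d\in\bar{\mathscr D}}$, that is a positive linear functional on bounded real nets on $\bar{\mathscr D}$ which extends the limit. A process $(Y_u:u\in U)$ is of $P$-uniformly integrable variation if the random variables $\sum_{u\cap v^c\in d}|Y_u-P(Y_v|\bar{\mathscr A}_u)|$, $d\in\bar{\mathscr D}$, are uniformly $P$-integrable. Let $\bar X=(\bar X_u:u\in U)$ be a positive, strong $P$-supermartingale on $\bar{\mathbb A}$, i.e. a positive (adapted, integrable) supermartingale such that, with $\bar m_u(F)=P(\bar X_u1_F)$ for $F\in\bar{\mathscr A}_u$, one has $\sup_{d\in\bar{\mathscr D}}\sum_{u\cap v^c\in d}\|\bar m_u-\bar m_v|_{\bar{\mathscr A}_u}\|<\infty$ (total variation norm), and $\sum_{n=1}^N\bar m_{t_n}(f_n)=0$ whenever $t_n\in U$, the $f_n$ are bounded and $\bar{\mathscr A}_{t_n}$-measurable, and $\sum_{n=1}^Nf_n1_{t_n}=0$ on $\bar\Omega$. Then $\bar X$ is of $P$-uniformly integrable variation if and only if there are $M\in L^1(P)$ and an integrable process $(\bar A_u:u\in U)$ adapted to $\bar{\mathbb A}$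 such that 1. $P(0=\bar A_{\bar\Omega}\le\bar A_u\le\bar A_v)=1$ for all $u\le v$ in $U$; 2. $P(\bar X_u1_F)=P((M-\bar A_u)1_F)$ for all $u\in U$, $F\in\bar{\mathscr A}_u$; 3. $P\int f\,d\bar A=\mathrm{LIM}_{d\in\bar{\mathscr D}}\,P\int\bar{\mathscr P}^d_P(f)\,d\bar A$ for every $f=\sum_{n=1}^Nf_n1_{t_n}$ with $t_n\in U$ and $f_n$ bounded and $\mathscr F$-measurable; 4. $\bar A$ is of $P$-uniformly integrable variation. Here $\bar{\mathscr P}^d_P(f)=\sum_{u\cap v^c\in d}P\big(\inf_{i:(\cdot,i)\in u\cap v^c}f(\cdot,i)\,\big|\,\bar{\mathscr A}_u\big)1_{u\cap v^c}$, and $P\int f\,d\bar A=P\sum_{u\cap v^c\in d}f_{u,v}(\bar A_v-\bar A_u)$ when $f=\sum_{u\cap v^c\in d}f_{u,v}1_{u\cap v^c}$ with $d\in\bar{\mathscr D}$; for each $d$ the integral $P\int\bar{\mathscr P}^d_P(f)\,d\bar A$ is computed with the displayed representation of $\bar{\mathscr P}^d_P(f)$, and condition 3 is required for every representation of $f$ of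 this form. Moreover, a pair $(M,\bar A)$ that satisfies 1--3 is unique: $M$ up to $P$-null sets and $\bar A$ up to modification. -/

import Mathlib

open MeasureTheory Filter Topology
open scoped ENNReal

noncomputable section

namespace SetIndexed

/-! A family `U` of subsets of `Ω × I`, closed under union and intersection and ordered by
REVERSE inclusion, is a sublattice of `(Set (Ω × I))ᵒᵈ`: for `u v : U`, `u ≤ v` means that the
set of `v` is contained in the set of `u`. -/

/-- The subset of `Ω × I` that an index `u : U` is. -/
def toSet {Ω I : Type*} {U : Sublattice (Set (Ω × I))ᵒᵈ} (u : U) : Set (Ω × I) :=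
  OrderDual.ofDual (u : (Set (Ω × I))ᵒᵈ)

/-- The set `s ∩ tᶜ`. -/
def diff {Ω I : Type*} {U : Sublattice (Set (Ω × I))ᵒᵈ} (s t : U) : Set (Ω × I) :=
  toSet s \ toSet t

/-- The event `{s < t}`, the projection of `s ∩ tᶜ` on `Ω`. -/
def ltEvent {Ω I : Type*} {U : Sublattice (Set (Ω × I))ᵒᵈ} (s t : U) : Set Ω :=
  {ω | ∃ i, (ω, i) ∈ diff s t}

/-- The standing assumptions on the index family `U` and on the filtration `𝒜` of σ-algebras
indexed by `U` (that `𝒜` is increasing for reverse inclusion is part of `Filtration`).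
The ambient σ-algebra is the one that the filtration generates. -/
structure IsIndexedFiltration {Ω I : Type*} [mΩ : MeasurableSpace Ω]
    (U : Sublattice (Set (Ω × I))ᵒᵈ) (𝒜 : Filtration U mΩ) : Prop where
  univ_mem : OrderDual.toDual (Set.univ : Set (Ω × I)) ∈ U
  empty_mem : OrderDual.toDual (∅ : Set (Ω × I)) ∈ U
  section_mem : ∀ (s t : U) (F : Set Ω), MeasurableSet[𝒜 s] F → ∀ i : I,
    MeasurableSet[𝒜 s] (F ∩ {ω | (ω, i) ∈ diff s t}) ∧
      MeasurableSet[𝒜 t] (F ∩ {ω | (ω, i) ∈ diff s t})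
  ltEvent_mem : ∀ (s t : U) (F : Set Ω), MeasurableSet[𝒜 s] F →
    MeasurableSet[𝒜 s] (F ∩ ltEvent s t) ∧ MeasurableSet[𝒜 t] (F ∩ ltEvent s t)
  generates : mΩ = ⨆ u : U, 𝒜 u

/-- A finite disjoint collection of sets `u ∩ vᶜ` with `u ≤ v`; each member is recorded together
with the pair `(u, v)` that represents it. -/
@[ext]
structure DisjColl {Ω I : Type*} (U : Sublattice (Set (Ω × I))ᵒᵈ) where
  pairs : Finset (U × U)
  le : ∀ p ∈ pairs, p.1 ≤ p.2
  disj : ∀ p ∈ pairs, ∀ q ∈ pairs, p ≠ q → Disjoint (diff p.1 p.2) (diff q.1 q.2)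

/-- Refinement: `d ≤ d'` if each `u ∩ vᶜ` in `d` is the union of finitely many `uₙ ∩ vₙᶜ` in `d'`
with `u ≤ uₙ`. -/
instance {Ω I : Type*} (U : Sublattice (Set (Ω × I))ᵒᵈ) : Preorder (DisjColl U) where
  le d d' := ∀ p ∈ d.pairs, ∃ q : Finset (U × U), q ⊆ d'.pairs ∧ (∀ r ∈ q, p.1 ≤ r.1) ∧
    diff p.1 p.2 = ⋃ r ∈ q, diff r.1 r.2
  le_refl d p hp := ⟨{p}, by simpa using hp, by simp, by simp⟩
  le_trans d d' d'' h h' p hp := by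
    classical
    obtain ⟨q, hq, hle, hEq⟩ := h p hp
    choose! k hk hkle hkEq using h'
    refine ⟨q.biUnion k, ?_, ?_, ?_⟩
    · intro r hr
      obtain ⟨a, ha, hra⟩ := Finset.mem_biUnion.1 hr
      exact hk a (hq ha) hra
    · intro r hr
      obtain ⟨a, ha, hra⟩ := Finset.mem_biUnion.1 hr
      exact (hle a ha).trans (hkle a (hq ha) r hra)
    · rw [hEq, Finset.set_biUnion_biUnion]
      exact Set.iUnion₂_congr fun a ha => hkEq a (hq ha)

/-- `L` is a Banach limit along the directed set `D`: on bounded real nets it is linear, positive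
and extends the ordinary limit (its values on unbounded nets are irrelevant). -/
structure IsBanachLimit {D : Type*} [Preorder D] (L : (D → ℝ) → ℝ) : Prop where
  add : ∀ x y : D → ℝ, (∃ C, ∀ d, |x d| ≤ C) → (∃ C, ∀ d, |y d| ≤ C) →
    L (fun d => x d + y d) = L x + L y
  smul : ∀ (c : ℝ) (x : D → ℝ), (∃ C, ∀ d, |x d| ≤ C) → L (fun d => c * x d) = c * L x
  nonneg : ∀ x : D → ℝ, (∃ C, ∀ d, |x d| ≤ C) → (∀ d, 0 ≤ x d) → 0 ≤ L x
  lim : ∀ (x : D → ℝ) (a : ℝ), (∃ C, ∀ d, |x d| ≤ C) → Tendsto x atTop (𝓝 a) → L x = a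

/-- The norm (total variation) of a finitely additive set function `μ` on a σ-algebra `m`. -/
def totVar {Ω : Type*} (m : MeasurableSpace Ω) (μ : Set Ω → ℝ) : ℝ≥0∞ :=
  ⨆ (π : Finset (Set Ω)) (_ : (∀ F ∈ π, MeasurableSet[m] F) ∧
    (π : Set (Set Ω)).PairwiseDisjoint id), ∑ F ∈ π, ENNReal.ofReal |μ F|

/-- `f` belongs to the class of bounded functions measurable for the σ-algebra `m`. -/
def BddMeas {Ω : Type*} (m : MeasurableSpace Ω) (f : Ω → ℝ) : Prop :=
  Measurable[m] f ∧ ∃ C, ∀ ω, |f ω| ≤ C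

/-- The finitely additive process associated to `X`: `F ↦ P (X_u 1_F)`. -/
def assoc {Ω ι : Type*} [MeasurableSpace Ω] (P : Measure Ω) (X : ι → Ω → ℝ) (u : ι) (F : Set Ω) :
    ℝ :=
  ∫ ω in F, X u ω ∂P

/-- The integral `m_u(f)` of a bounded `f` for the associated finitely additive process. -/
def assocInt {Ω ι : Type*} [MeasurableSpace Ω] (P : Measure Ω) (X : ι → Ω → ℝ) (u : ι)
    (f : Ω → ℝ) : ℝ :=
  ∫ ω, f ω * X u ω ∂P

/-- A positive, strong `P` supermartingale: a positive `P` supermartingale whose associated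
finitely additive supermartingale `m` is of bounded variation and such that
`0 = ∑ fₙ 1_{tₙ}`, with `fₙ` bounded and measurable for the σ-algebra of `tₙ`,
implies `∑ m_{tₙ}(fₙ) = 0`. -/
structure IsPosStrongSupermartingale {Ω I : Type*} [mΩ : MeasurableSpace Ω] (P : Measure Ω)
    {U : Sublattice (Set (Ω × I))ᵒᵈ} (𝒜 : Filtration U mΩ) (X : U → Ω → ℝ) : Prop where
  supermartingale : Supermartingale X 𝒜 P
  nonneg : ∀ u, 0 ≤ᵐ[P] X u
  bounded_variation :
    (⨆ d : DisjColl U, ∑ p ∈ d.pairs,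
      totVar (𝒜 p.1) (fun F => assoc P X p.1 F - assoc P X p.2 F)) < ∞
  strong : ∀ (N : ℕ) (t : Fin N → U) (f : Fin N → Ω → ℝ), (∀ n, BddMeas (𝒜 (t n)) (f n)) →
    (∀ x : Ω × I, ∑ n, (toSet (t n)).indicator (fun y => f n y.1) x = 0) →
    ∑ n, assocInt P X (t n) (f n) = 0

/-- `Y` is of `P` uniformly integrable variation: the sums `∑ |Y_u - P(Y_v | 𝒜_u)|` over the
members `u ∩ vᶜ` of the finite disjoint collections are uniformly `P` integrable. -/
def IsUIVariation {Ω I : Type*} [mΩ : MeasurableSpace Ω] (P : Measure Ω)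
    {U : Sublattice (Set (Ω × I))ᵒᵈ} (𝒜 : Filtration U mΩ) (Y : U → Ω → ℝ) : Prop :=
  UniformIntegrable
    (fun (d : DisjColl U) ω => ∑ p ∈ d.pairs, |Y p.1 ω - (P[Y p.2 | 𝒜 p.1]) ω|) 1 P

/-- The process `∑ g_{(u,v)} 1_{u ∩ vᶜ}`, the sum being over the members of `d`. -/
def simpleProc {Ω I : Type*} {U : Sublattice (Set (Ω × I))ᵒᵈ} (d : DisjColl U)
    (g : U × U → Ω → ℝ) (x : Ω × I) : ℝ :=
  ∑ p ∈ d.pairs, (diff p.1 p.2).indicator (fun y => g p y.1) x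

/-- `P ∫ f dA` for `f = simpleProc d g`, that is `P ∑ g_{(u,v)} (A_v - A_u)`. -/
def meanInt {Ω I : Type*} [MeasurableSpace Ω] (P : Measure Ω)
    {U : Sublattice (Set (Ω × I))ᵒᵈ} (A : U → Ω → ℝ) (d : DisjColl U) (g : U × U → Ω → ℝ) : ℝ :=
  ∫ ω, ∑ p ∈ d.pairs, g p ω * (A p.2 ω - A p.1 ω) ∂P

/-- The coefficient `P(inf_{i ∈ u ∩ vᶜ} b(i) | 𝒜_u)` of `1_{u ∩ vᶜ}` in the elementary process
which approximates the predictable projection of `b`. (The infimum over an empty section is `0`;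
such `ω` form the complement of `{u < v}`, a set of `𝒜_u` disjoint from `u ∩ vᶜ`.) -/
def predCoef {Ω I : Type*} [mΩ : MeasurableSpace Ω] (P : Measure Ω)
    {U : Sublattice (Set (Ω × I))ᵒᵈ} (𝒜 : Filtration U mΩ) (b : Ω × I → ℝ) (p : U × U) : Ω → ℝ :=
  P[fun ω => ⨅ i : {i : I // (ω, i) ∈ diff p.1 p.2}, b (ω, i) | 𝒜 p.1]

/-- The decomposition `X = M - A` of Doob and Meyer, relatively to the Banach limit `L`. -/
structure IsDoobMeyer {Ω I : Type*} [mΩ : MeasurableSpace Ω] (P : Measure Ω)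
    {U : Sublattice (Set (Ω × I))ᵒᵈ} (𝒜 : Filtration U mΩ) (L : (DisjColl U → ℝ) → ℝ)
    (X : U → Ω → ℝ) (M : Ω → ℝ) (A : U → Ω → ℝ) : Prop where
  integrable_M : Integrable M P
  integrable_A : ∀ u, Integrable (A u) P
  adapted : StronglyAdapted 𝒜 A
  zero : ∀ u : U, toSet u = Set.univ → A u =ᵐ[P] 0
  mono : ∀ u v : U, u ≤ v → A u ≤ᵐ[P] A v
  decomp : ∀ (u : U) (F : Set Ω), MeasurableSet[𝒜 u] F →
    assoc P X u F = ∫ ω in F, (M ω - A u ω) ∂P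
  /-- `P ∫ f dA = LIM_d P ∫ 𝒫^d(f) dA` for all `f = ∑ fₙ 1_{tₙ}` with `fₙ` bounded and
  measurable for the ambient σ-algebra, each written over some finite disjoint collection. -/
  natural : ∀ (d₀ : DisjColl U) (g : U × U → Ω → ℝ), (∀ p ∈ d₀.pairs, BddMeas mΩ (g p)) →
    meanInt P A d₀ g = L (fun d => meanInt P A d (predCoef P 𝒜 (simpleProc d₀ g)))

end SetIndexed

end

namespace SetIndexed

/-! ### Banach limits of bounded nets. -/

section BanachLimit

variable {D : Type*} [Preorder D] {L : (D → ℝ) → ℝ}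

/-! The compensator is built from the conditional decreases `X_u - P(X_v | 𝒜_u) ≥ 0`. For a set `S`,
the functional `limInt` sends `g` to the Banach limit along `d` of `P(g · sum of the decreases on
the members of d inside S)`. Uniform integrability makes it absolutely continuous with respect to
`P`, uniformly in `d`, so it has a density (`exists_limInt_density`).

The density for `S = uᶜ` can be replaced by its conditional expectation given `𝒜 u`: the decrease on
a member disjoint from `u` is almost surely `𝒜 u`-measurable, because it is carried by `{s < t}`
(`limInt_condExp`). This yields an adapted process `A`. As `limInt` is additive in `S` along fine
collections, `A_v - A_u` is the density over `u ∩ vᶜ`, whence monotonicity. Strongness makes the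
decreases telescope on events of `𝒜 u`, so their sum over `u ∩ vᶜ` has mean `m_u - m_v` there
(`integral_indicator_mul_incrSum`); with `v = ∅` this is the decomposition, with `M = A_∅`.
Condition 3 holds because, once `d` refines the collection of `f`, the integrals of the approximate
projections are exactly those whose Banach limit defines `A`.

Conversely, any decomposition forces `P(A_v | 𝒜_u) - A_u` to be the decrease of `X`
(`incr_ae_eq_of_decomp`). Hence `X` and `A` have the same variation sums, and the right side of
condition 3 depends on `X` alone, which gives uniqueness. -/

lemma IsBanachLimit.congr (hL : IsBanachLimit L) {x y : D → ℝ} (hx : ∃ C, ∀ d, |x d| ≤ C)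
    (hy : ∃ C, ∀ d, |y d| ≤ C) (h : x =ᶠ[atTop] y) : L x = L y := by
  obtain ⟨C, hC⟩ := hx
  obtain ⟨C', hC'⟩ := hy
  have hb : ∃ K, ∀ d, |x d - y d| ≤ K :=
    ⟨C + C', fun d => (abs_sub _ _).trans (add_le_add (hC d) (hC' d))⟩
  have h0 : L (fun d => x d - y d) = 0 :=
    hL.lim _ 0 hb (tendsto_const_nhds.congr' (h.mono fun d hd => by simp [hd]))
  have := hL.add y (fun d => x d - y d) ⟨C', hC'⟩ hb
  simpa [h0] using this

lemma IsBanachLimit.eventually_const (hL : IsBanachLimit L) {x : D → ℝ} {a : ℝ}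
    (hx : ∃ C, ∀ d, |x d| ≤ C) (h : ∀ᶠ d in atTop, x d = a) : L x = a :=
  hL.lim x a hx (tendsto_const_nhds.congr' (h.mono fun _ hd => hd.symm))

lemma IsBanachLimit.const (hL : IsBanachLimit L) (a : ℝ) : L (fun _ => a) = a :=
  hL.eventually_const ⟨|a|, fun _ => le_rfl⟩ (Eventually.of_forall fun _ => rfl)

lemma IsBanachLimit.mono (hL : IsBanachLimit L) {x y : D → ℝ} (hx : ∃ C, ∀ d, |x d| ≤ C)
    (hy : ∃ C, ∀ d, |y d| ≤ C) (h : ∀ d, x d ≤ y d) : L x ≤ L y := by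
  obtain ⟨C, hC⟩ := hx
  obtain ⟨C', hC'⟩ := hy
  have hb : ∃ K, ∀ d, |y d - x d| ≤ K :=
    ⟨C' + C, fun d => (abs_sub _ _).trans (add_le_add (hC' d) (hC d))⟩
  have h0 := hL.nonneg (fun d => y d - x d) hb fun d => sub_nonneg.2 (h d)
  have := hL.add x (fun d => y d - x d) ⟨C, hC⟩ hb
  simp only [add_sub_cancel] at this
  linarith

lemma IsBanachLimit.abs_le (hL : IsBanachLimit L) {x : D → ℝ} {C : ℝ} (hx : ∀ d, |x d| ≤ C) :
    |L x| ≤ C := by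
  have hc (a : ℝ) : ∃ K, ∀ _ : D, |a| ≤ K := ⟨|a|, fun _ => le_rfl⟩
  rw [_root_.abs_le]
  constructor
  · rw [← hL.const (-C)]
    exact hL.mono (hc _) ⟨C, hx⟩ fun d => (_root_.abs_le.1 (hx d)).1
  · rw [← hL.const C]
    exact hL.mono ⟨C, hx⟩ (hc _) fun d => (_root_.abs_le.1 (hx d)).2

lemma IsBanachLimit.sum (hL : IsBanachLimit L) {κ : Type*} (s : Finset κ) (x : κ → D → ℝ)
    (hx : ∀ k ∈ s, ∃ C, ∀ d, |x k d| ≤ C) :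
    (∃ C, ∀ d, |∑ k ∈ s, x k d| ≤ C) ∧ L (fun d => ∑ k ∈ s, x k d) = ∑ k ∈ s, L (x k) := by
  classical
  induction s using Finset.induction_on with
  | empty => simpa using ⟨⟨0, fun _ => le_rfl⟩, hL.const 0⟩
  | insert a s ha ih =>
    obtain ⟨⟨C, hC⟩, h⟩ := ih fun k hk => hx k (Finset.mem_insert_of_mem hk)
    obtain ⟨C', hC'⟩ := hx a (Finset.mem_insert_self _ _)
    simp only [Finset.sum_insert ha]
    refine ⟨⟨C' + C, fun d => (abs_add_le _ _).trans (add_le_add (hC' d) (hC d))⟩, ?_⟩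
    rw [hL.add _ _ ⟨C', hC'⟩ ⟨C, hC⟩, h]

end BanachLimit

/-! ### Conditional expectation as a self-adjoint operator. -/

section CondExp

variable {Ω : Type*} {m mΩ : MeasurableSpace Ω} {P : Measure Ω}

lemma integral_mul_condExp [IsFiniteMeasure P] (hm : m ≤ mΩ) {g f : Ω → ℝ} (hg : StronglyMeasurable[m] g)
    (hgf : Integrable (g * f) P) (hf : Integrable f P) :
    ∫ ω, g ω * (P[f | m]) ω ∂P = ∫ ω, g ω * f ω ∂P := by
  have h := condExp_mul_of_stronglyMeasurable_left hg hgf hf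
  calc ∫ ω, g ω * (P[f | m]) ω ∂P = ∫ ω, (P[g * f | m]) ω ∂P :=
        integral_congr_ae (h.mono fun ω hω => by simp [hω])
    _ = _ := integral_condExp hm

lemma integrable_mul_of_bdd {g f : Ω → ℝ} {C : ℝ} (hg : AEStronglyMeasurable g P)
    (hb : ∀ᵐ ω ∂P, |g ω| ≤ C) (hf : Integrable f P) : Integrable (fun ω => g ω * f ω) P :=
  hf.bdd_mul hg hb

lemma abs_condExp_le {g : Ω → ℝ} {C : ℝ} (hb : ∀ᵐ ω ∂P, |g ω| ≤ C) :
    ∀ᵐ ω ∂P, |(P[g | m]) ω| ≤ C :=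
  ae_bdd_abs_condExp_of_ae_bdd_abs hb

lemma integral_condExp_mul [IsFiniteMeasure P] (hm : m ≤ mΩ) {g f : Ω → ℝ} {C : ℝ}
    (hg : AEStronglyMeasurable g P) (hb : ∀ᵐ ω ∂P, |g ω| ≤ C) (hf : Integrable f P) :
    ∫ ω, (P[g | m]) ω * f ω ∂P = ∫ ω, g ω * (P[f | m]) ω ∂P := by
  have hgi : Integrable g P := Integrable.of_bound hg C hb
  have hsm : AEStronglyMeasurable (P[g | m]) P :=
    (stronglyMeasurable_condExp.mono hm).aestronglyMeasurable
  rw [← integral_mul_condExp hm stronglyMeasurable_condExp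
    (integrable_mul_of_bdd hsm (abs_condExp_le hb) hf) hf]
  simp_rw [mul_comm ((P[g | m]) _)]
  rw [integral_mul_condExp hm stronglyMeasurable_condExp _ hgi]
  · simp_rw [mul_comm]
  · have := integrable_mul_of_bdd hg hb (integrable_condExp (m := m) (f := f) (μ := P))
    exact this.congr (ae_of_all _ fun ω => mul_comm _ _)

end CondExp

/-! ### Densities of absolutely continuous functionals. -/

section Density

variable {Ω : Type*} {mΩ : MeasurableSpace Ω} {P : Measure Ω}

/-- The tails of a disjoint union have `P`-measure tending to `0`, so the ε-δ condition upgrades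
finite additivity to countable additivity; Radon–Nikodym then applies. A Banach limit preserves only
finite additivity, which is why this is needed. -/
lemma exists_density [IsFiniteMeasure P] (ℓ : Set Ω → ℝ) (h_nonneg : ∀ F, MeasurableSet F → 0 ≤ ℓ F)
    (h_add : ∀ F G, MeasurableSet F → MeasurableSet G → Disjoint F G → ℓ (F ∪ G) = ℓ F + ℓ G)
    (h_ac : ∀ ε > 0, ∃ δ > 0, ∀ F, MeasurableSet F → P F ≤ ENNReal.ofReal δ → ℓ F ≤ ε) :
    ∃ h : Ω → ℝ, Integrable h P ∧ 0 ≤ᵐ[P] h ∧ ∀ F, MeasurableSet F → ℓ F = ∫ ω in F, h ω ∂P := by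
  classical
  have h_empty : ℓ ∅ = 0 := by
    have := h_add ∅ ∅ .empty .empty (by simp)
    simp at this
    exact this
  have h_finite (f : ℕ → Set Ω) (hf : ∀ i, MeasurableSet (f i))
      (hd : Pairwise (Function.onFun Disjoint f)) (n : ℕ) :
      ℓ (⋃ i, f i) = ∑ i ∈ Finset.range n, ℓ (f i) + ℓ (⋃ i ≥ n, f i) := by
    induction n with
    | zero => simp
    | succ n ih =>
      rw [ih, Finset.sum_range_succ, add_assoc, ← h_add _ _ (hf n)
        (.iUnion fun i => .iUnion fun _ => hf i)]
      · congr 2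
        ext ω
        simp only [Set.mem_iUnion, Set.mem_union, ge_iff_le, exists_prop]
        constructor
        · rintro ⟨i, hi, h⟩
          rcases hi.eq_or_lt with rfl | hi
          · exact .inl h
          · exact .inr ⟨i, hi, h⟩
        · rintro (h | ⟨i, hi, h⟩)
          · exact ⟨n, le_rfl, h⟩
          · exact ⟨i, by omega, h⟩
      · simp only [Set.disjoint_iUnion_right]
        exact fun i hi => hd (by omega)
  let ν : SignedMeasure Ω :=
    { measureOf' := fun F => if MeasurableSet F then ℓ F else 0
      empty' := by simp [h_empty]
      not_measurable' := fun F hF => if_neg hF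
      m_iUnion' := fun f hf hd => by
        simp only [hf, MeasurableSet.iUnion hf, if_true]
        rw [hasSum_iff_tendsto_nat_of_nonneg fun i => h_nonneg _ (hf i)]
        have h0 : Tendsto (fun n => ℓ (⋃ i ≥ n, f i)) atTop (𝓝 0) := by
          have hP := tendsto_measure_biUnion_Ici_zero_of_pairwise_disjoint (μ := P)
            (fun i => (hf i).nullMeasurableSet) hd
          rw [Metric.tendsto_atTop']
          intro ε hε
          obtain ⟨δ, hδ, h⟩ := h_ac (ε / 2) (half_pos hε)
          have := (tendsto_order.1 hP).2 (ENNReal.ofReal δ) (by simpa using hδ)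
          obtain ⟨N, hN⟩ := eventually_atTop.1 this
          refine ⟨N, fun n hn => ?_⟩
          have hm : MeasurableSet (⋃ i ≥ n, f i) := .iUnion fun i => .iUnion fun _ => hf i
          rw [Real.dist_eq, sub_zero, abs_of_nonneg (h_nonneg _ hm)]
          exact (h _ hm (hN n hn.le).le).trans_lt (by linarith)
        have : (fun n => ∑ i ∈ Finset.range n, ℓ (f i)) =
            fun n => ℓ (⋃ i, f i) - ℓ (⋃ i ≥ n, f i) :=
          funext fun n => by rw [h_finite f hf hd n]; ring
        rw [this]
        simpa using tendsto_const_nhds.sub h0 }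
  have hν (F : Set Ω) (hF : MeasurableSet F) : ν F = ℓ F := if_pos hF
  have h_abs : ν ≪ᵥ P.toENNRealVectorMeasure := by
    refine VectorMeasure.AbsolutelyContinuous.mk fun F hF h0 => ?_
    rw [hν F hF]
    rw [Measure.toENNRealVectorMeasure_apply_measurable hF] at h0
    refine le_antisymm (le_of_forall_pos_le_add fun ε hε => ?_) (h_nonneg F hF)
    obtain ⟨δ, -, h⟩ := h_ac ε hε
    simpa using h F hF (by simp [h0])
  have h_int : Integrable (ν.rnDeriv P) P := SignedMeasure.integrable_rnDeriv ν P
  have h_eq (F : Set Ω) (hF : MeasurableSet F) : ℓ F = ∫ ω in F, ν.rnDeriv P ω ∂P := by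
    rw [← hν F hF, ← withDensityᵥ_apply h_int hF,
      SignedMeasure.withDensityᵥ_rnDeriv_eq ν P h_abs]
  refine ⟨ν.rnDeriv P, h_int, ?_, h_eq⟩
  exact ae_nonneg_of_forall_setIntegral_nonneg h_int
    fun F hF _ => h_eq F hF ▸ h_nonneg F hF

lemma exists_simpleFunc_abs_sub_le {g : Ω → ℝ} (hg : BddMeas mΩ g) {ε : ℝ} (hε : 0 < ε) :
    ∃ φ : SimpleFunc Ω ℝ, ∀ ω, |g ω - φ ω| ≤ ε := by
  obtain ⟨hm, C, hC⟩ := hg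
  have hfloor : Measurable fun ω => ⌊g ω / ε⌋ := Int.measurable_floor.comp (hm.div_const ε)
  -- Rounding `g` down to a multiple of `ε` takes finitely many values because `g` is bounded.
  have hfin : (Set.range fun ω => ⌊g ω / ε⌋).Finite := by
    refine (Set.finite_Icc ⌊-C / ε⌋ ⌊C / ε⌋).subset ?_
    rintro _ ⟨ω, rfl⟩
    have := abs_le.1 (hC ω)
    exact ⟨Int.floor_le_floor (by gcongr; exact this.1),
      Int.floor_le_floor (by gcongr; exact this.2)⟩
  let ψ : SimpleFunc Ω ℤ := ⟨_, fun n => hfloor (measurableSet_singleton n), hfin⟩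
  refine ⟨ψ.map fun n : ℤ => ε * (n : ℝ), fun ω => ?_⟩
  have h1 := Int.floor_le (g ω / ε)
  have h2 := Int.lt_floor_add_one (g ω / ε)
  have h3 : g ω = ε * (g ω / ε) := by field_simp
  change |g ω - ε * (⌊g ω / ε⌋ : ℝ)| ≤ ε
  rw [abs_le]
  constructor <;> nlinarith

lemma SimpleFunc.bddMeas (φ : SimpleFunc Ω ℝ) : BddMeas mΩ φ :=
  ⟨φ.measurable, by
    obtain ⟨C, hC⟩ := φ.exists_forall_norm_le
    exact ⟨C, hC⟩⟩

/-- Simple functions are uniformly dense in the bounded measurable ones, and `Ψ` is continuous for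
the sup norm. -/
lemma eq_zero_of_indicator_eq_zero {Ψ : (Ω → ℝ) → ℝ} {K : ℝ}
    (h_add : ∀ f g, BddMeas mΩ f → BddMeas mΩ g → Ψ (f + g) = Ψ f + Ψ g)
    (h_smul : ∀ (c : ℝ) f, BddMeas mΩ f → Ψ (c • f) = c * Ψ f)
    (h_bdd : ∀ f C, BddMeas mΩ f → (∀ ω, |f ω| ≤ C) → |Ψ f| ≤ C * K)
    (h_ind : ∀ F, MeasurableSet F → Ψ (F.indicator 1) = 0) {g : Ω → ℝ} (hg : BddMeas mΩ g) :
    Ψ g = 0 := by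
  have h_simple (φ : SimpleFunc Ω ℝ) : Ψ φ = 0 := by
    induction φ using SimpleFunc.induction with
    | @const c F hF =>
      have hb : BddMeas mΩ (F.indicator (1 : Ω → ℝ)) := by
        refine ⟨measurable_one.indicator hF, 1, fun ω => ?_⟩
        by_cases h : ω ∈ F <;> simp [h]
      have : ⇑(SimpleFunc.piecewise F hF (SimpleFunc.const Ω c) (SimpleFunc.const Ω 0)) =
          c • F.indicator (1 : Ω → ℝ) := by
        ext ω
        by_cases h : ω ∈ F <;> simp [h]
      rw [this, h_smul c _ hb, h_ind F hF, mul_zero]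
    | @add φ ψ _ h1 h2 =>
      rw [SimpleFunc.coe_add, h_add _ _ (SimpleFunc.bddMeas φ) (SimpleFunc.bddMeas ψ), h1, h2,
        add_zero]
  have h_le (ε : ℝ) (hε : 0 < ε) : |Ψ g| ≤ ε * K := by
    obtain ⟨φ, hφ⟩ := exists_simpleFunc_abs_sub_le hg hε
    have hb : BddMeas mΩ (g - φ) := ⟨hg.1.sub φ.measurable, ε, hφ⟩
    have := h_add (g - φ) φ hb (SimpleFunc.bddMeas φ)
    rw [sub_add_cancel, h_simple φ, add_zero] at this
    rw [this]
    exact h_bdd _ _ hb hφ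
  have h_lim : Tendsto (fun ε : ℝ => ε * K) (𝓝[>] 0) (𝓝 0) := by
    have : Tendsto (fun ε : ℝ => ε * K) (𝓝 0) (𝓝 (0 * K)) := tendsto_id.mul_const K
    rw [zero_mul] at this
    exact this.mono_left nhdsWithin_le_nhds
  have := ge_of_tendsto h_lim (eventually_nhdsWithin_of_forall fun ε hε => h_le ε hε)
  exact abs_nonpos_iff.1 this

lemma integral_abs_le_of_eLpNorm_le {f : Ω → ℝ} {C : ℝ} (hC : 0 ≤ C) (hf : AEStronglyMeasurable f P)
    (h : eLpNorm f 1 P ≤ ENNReal.ofReal C) : ∫ ω, |f ω| ∂P ≤ C := by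
  rw [eLpNorm_one_eq_lintegral_enorm] at h
  have := integral_norm_eq_lintegral_enorm hf
  simp only [Real.norm_eq_abs] at this
  rw [this]
  exact ENNReal.toReal_le_of_le_ofReal hC h

/-- Truncating a measurable version works. It serves conditional expectations, which are bounded
only almost everywhere. -/
lemma exists_bddMeas_ae_eq {g : Ω → ℝ} {C : ℝ} (hC : 0 ≤ C) (hg : AEStronglyMeasurable g P)
    (hb : ∀ᵐ ω ∂P, |g ω| ≤ C) : ∃ g' : Ω → ℝ, BddMeas mΩ g' ∧ g =ᵐ[P] g' := by
  refine ⟨fun ω => max (-C) (min C (hg.mk g ω)),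
    ⟨measurable_const.max (measurable_const.min hg.stronglyMeasurable_mk.measurable), C,
      fun ω => abs_le.2 ⟨le_max_left _ _, max_le (by linarith) (min_le_left _ _)⟩⟩, ?_⟩
  filter_upwards [hg.ae_eq_mk, hb] with ω h1 h2
  rw [← h1, min_eq_right (abs_le.1 h2).2, max_eq_right (abs_le.1 h2).1]

end Density

end SetIndexed

namespace SetIndexed

section BddMeas

variable {Ω : Type*}

lemma BddMeas.indicator_one {m : MeasurableSpace Ω} {F : Set Ω} (hF : MeasurableSet[m] F) :
    BddMeas m (F.indicator (1 : Ω → ℝ)) := by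
  refine ⟨measurable_one.indicator hF, 1, fun ω => ?_⟩
  by_cases h : ω ∈ F <;> simp [h]

lemma BddMeas.mono {m m' : MeasurableSpace Ω} {f : Ω → ℝ} (hf : BddMeas m f) (h : m ≤ m') :
    BddMeas m' f :=
  ⟨hf.1.mono h le_rfl, hf.2⟩

lemma BddMeas.neg {m : MeasurableSpace Ω} {f : Ω → ℝ} (hf : BddMeas m f) :
    BddMeas m (fun ω => -f ω) :=
  ⟨hf.1.neg, by simpa using hf.2⟩

lemma BddMeas.exists_nonneg_bound {m : MeasurableSpace Ω} {f : Ω → ℝ} (hf : BddMeas m f) :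
    ∃ C, 0 ≤ C ∧ ∀ ω, |f ω| ≤ C := by
  obtain ⟨-, C, hC⟩ := hf
  exact ⟨max C 0, le_max_right _ _, fun ω => (hC ω).trans (le_max_left _ _)⟩

lemma BddMeas.add {m : MeasurableSpace Ω} {f g : Ω → ℝ} (hf : BddMeas m f) (hg : BddMeas m g) :
    BddMeas m (f + g) := by
  obtain ⟨hf, C, hC⟩ := hf
  obtain ⟨hg, C', hC'⟩ := hg
  exact ⟨hf.add hg, C + C', fun ω => (abs_add_le _ _).trans (add_le_add (hC ω) (hC' ω))⟩

lemma BddMeas.const_smul {m : MeasurableSpace Ω} {f : Ω → ℝ} (hf : BddMeas m f) (c : ℝ) :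
    BddMeas m (c • f) := by
  obtain ⟨hf, C, hC⟩ := hf
  refine ⟨hf.const_smul c, |c| * C, fun ω => ?_⟩
  rw [Pi.smul_apply, smul_eq_mul, abs_mul]
  exact mul_le_mul_of_nonneg_left (hC ω) (abs_nonneg c)

end BddMeas

/-! ### Members of a collection under refinement. -/

section Collections

variable {Ω I : Type*} {U : Sublattice (Set (Ω × I))ᵒᵈ}

lemma le_iff_subset {u v : U} : u ≤ v ↔ toSet v ⊆ toSet u := Iff.rfl

/-- The collection with the single member `u ∩ vᶜ`. -/
def DisjColl.single (p : U × U) (hp : p.1 ≤ p.2) : DisjColl U where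
  pairs := {p}
  le q hq := by rwa [Finset.mem_singleton.1 hq]
  disj q hq r hr h := absurd ((Finset.mem_singleton.1 hq).trans (Finset.mem_singleton.1 hr).symm) h

lemma DisjColl.subset_or_disjoint {d₀ d : DisjColl U} (h : d₀ ≤ d) {p r : U × U}
    (hp : p ∈ d₀.pairs) (hr : r ∈ d.pairs) :
    diff r.1 r.2 ⊆ diff p.1 p.2 ∨ Disjoint (diff r.1 r.2) (diff p.1 p.2) := by
  obtain ⟨q, hq, -, h_eq⟩ := h p hp
  rw [or_iff_not_imp_right, Set.not_disjoint_iff]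
  rintro ⟨x, hxr, hxp⟩
  rw [h_eq, Set.mem_iUnion₂] at hxp
  obtain ⟨r', hr', hx⟩ := hxp
  have : r = r' := by
    by_contra hne
    exact Set.disjoint_left.1 (d.disj r hr r' (hq hr') hne) hxr hx
  subst this
  rw [h_eq]
  exact Set.subset_biUnion_of_mem (u := fun r : U × U => diff r.1 r.2) hr'

open Classical in
/-- The nonempty members of a collection that are contained in a given set. -/
noncomputable def DisjColl.inside (d : DisjColl U) (S : Set (Ω × I)) : Finset (U × U) :=
  d.pairs.filter fun p => diff p.1 p.2 ⊆ S ∧ (diff p.1 p.2).Nonempty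

lemma DisjColl.mem_inside {d : DisjColl U} {S : Set (Ω × I)} {p : U × U} :
    p ∈ d.inside S ↔ p ∈ d.pairs ∧ diff p.1 p.2 ⊆ S ∧ (diff p.1 p.2).Nonempty := by
  classical
  simp [DisjColl.inside]

/-- A point of `r` lies in some member of the subfamily that refines `p`, and disjointness
identifies that member with `r`. An empty `r` would carry no information on `r.1`; hence the
nonemptiness in `inside`. -/
lemma DisjColl.le_of_mem_inside {d : DisjColl U} {p r : U × U} (hp : p.1 ≤ p.2)
    (h : DisjColl.single p hp ≤ d) (hr : r ∈ d.inside (diff p.1 p.2)) : p.1 ≤ r.1 := by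
  obtain ⟨hrd, hsub, x, hx⟩ := DisjColl.mem_inside.1 hr
  obtain ⟨q, hq, hle, h_eq⟩ := h p (Finset.mem_singleton_self p)
  have hxp := hsub hx
  rw [h_eq, Set.mem_iUnion₂] at hxp
  obtain ⟨r', hr', hx'⟩ := hxp
  have : r = r' := by
    by_contra hne
    exact Set.disjoint_left.1 (d.disj r hrd r' (hq hr') hne) hx hx'
  exact this ▸ hle r' hr'

lemma DisjColl.sum_indicator_inside {d : DisjColl U} {p : U × U} (hp : p.1 ≤ p.2)
    (h : DisjColl.single p hp ≤ d) (f : Ω × I → ℝ) (x : Ω × I) :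
    ∑ r ∈ d.inside (diff p.1 p.2), (diff r.1 r.2).indicator f x = (diff p.1 p.2).indicator f x := by
  by_cases hx : x ∈ diff p.1 p.2
  · obtain ⟨q, hq, -, h_eq⟩ := h p (Finset.mem_singleton_self p)
    have hx' := hx
    rw [h_eq, Set.mem_iUnion₂] at hx'
    obtain ⟨r, hr, hxr⟩ := hx'
    rw [Set.indicator_of_mem hx, Finset.sum_eq_single_of_mem r, Set.indicator_of_mem hxr]
    · refine DisjColl.mem_inside.2 ⟨hq hr, ?_, x, hxr⟩
      rw [h_eq]
      exact Set.subset_biUnion_of_mem (u := fun r : U × U => diff r.1 r.2) hr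
    · intro b hb hne
      refine Set.indicator_of_notMem (fun hxb => ?_) _
      exact Set.disjoint_left.1 (d.disj b (DisjColl.mem_inside.1 hb).1 r (hq hr) hne) hxb hxr
  · rw [Set.indicator_of_notMem hx]
    refine Finset.sum_eq_zero fun r hr => Set.indicator_of_notMem (fun hxr => hx ?_) _
    exact (DisjColl.mem_inside.1 hr).2.1 hxr

lemma indicator_diff {s t : U} (h : s ≤ t) (f : Ω × I → ℝ) (x : Ω × I) :
    (diff s t).indicator f x = (toSet s).indicator f x - (toSet t).indicator f x := by
  have h_sub : x ∈ toSet t → x ∈ toSet s := fun hx => le_iff_subset.1 h hx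
  by_cases hs : x ∈ toSet s <;> by_cases ht : x ∈ toSet t <;> simp_all [diff, Set.indicator]

end Collections

variable {Ω I : Type*} [mΩ : MeasurableSpace Ω] {P : Measure Ω}
  {U : Sublattice (Set (Ω × I))ᵒᵈ} {𝒜 : Filtration U mΩ} {X : U → Ω → ℝ}

/-- The conditional expectation of the decrease of `X` on `u ∩ vᶜ`. -/
noncomputable def incr (P : Measure Ω) (𝒜 : Filtration U mΩ) (X : U → Ω → ℝ) (p : U × U) : Ω → ℝ :=
  X p.1 - P[X p.2 | 𝒜 p.1]

/-- The sum of the conditional decreases of `X` on the members of `d` inside `S`. -/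
noncomputable def incrSum (P : Measure Ω) (𝒜 : Filtration U mΩ) (X : U → Ω → ℝ) (S : Set (Ω × I))
    (d : DisjColl U) (ω : Ω) : ℝ :=
  ∑ p ∈ d.inside S, incr P 𝒜 X p ω

/-- The limit along `d` of the mean integrals of `g 1_S` for the conditional decreases of `X`. -/
noncomputable def limInt (P : Measure Ω) (𝒜 : Filtration U mΩ) (L : (DisjColl U → ℝ) → ℝ) (X : U → Ω → ℝ)
    (S : Set (Ω × I)) (g : Ω → ℝ) : ℝ :=
  L fun d => ∫ ω, g ω * incrSum P 𝒜 X S d ω ∂P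

/-! ### Conditional decreases: sign, support and measurability. -/

section Incr

lemma integrable_incr (hX : ∀ u, Integrable (X u) P) (p : U × U) : Integrable (incr P 𝒜 X p) P :=
  (hX _).sub integrable_condExp

lemma stronglyMeasurable_incr (hX : StronglyAdapted 𝒜 X) (p : U × U) :
    StronglyMeasurable[𝒜 p.1] (incr P 𝒜 X p) :=
  (hX _).sub stronglyMeasurable_condExp

lemma integrable_incrSum (hX : ∀ u, Integrable (X u) P) (S : Set (Ω × I)) (d : DisjColl U) :
    Integrable (incrSum P 𝒜 X S d) P :=
  integrable_finsetSum _ fun p _ => integrable_incr hX p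

lemma IsPosStrongSupermartingale.incr_nonneg (hX : IsPosStrongSupermartingale P 𝒜 X) {p : U × U}
    (hp : p.1 ≤ p.2) : 0 ≤ᵐ[P] incr P 𝒜 X p := by
  filter_upwards [hX.supermartingale.2.1 p.1 p.2 hp] with ω hω
  simpa [incr] using hω

lemma IsPosStrongSupermartingale.strong_fintype (hX : IsPosStrongSupermartingale P 𝒜 X)
    {κ : Type*} [Fintype κ] (t : κ → U) (f : κ → Ω → ℝ) (hf : ∀ n, BddMeas (𝒜 (t n)) (f n))
    (h : ∀ x : Ω × I, ∑ n, (toSet (t n)).indicator (fun y => f n y.1) x = 0) :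
    ∑ n, assocInt P X (t n) (f n) = 0 := by
  let e := (Fintype.equivFin κ).symm
  rw [← e.sum_comp]
  refine hX.strong _ (t ∘ e) (f ∘ e) (fun n => hf _) fun x => ?_
  rw [← h x, ← e.sum_comp]
  rfl

lemma BddMeas.aestronglyMeasurable {f : Ω → ℝ} (hf : BddMeas mΩ f) :
    AEStronglyMeasurable f P :=
  hf.1.aestronglyMeasurable

lemma BddMeas.integrable_mul {g f : Ω → ℝ} (hg : BddMeas mΩ g) (hf : Integrable f P) :
    Integrable (fun ω => g ω * f ω) P :=
  integrable_mul_of_bdd hg.aestronglyMeasurable (ae_of_all _ hg.2.choose_spec) hf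

variable [IsProbabilityMeasure P]

lemma IsIndexedFiltration.ltEvent_measurableSet (h𝒜 : IsIndexedFiltration U 𝒜) (s t : U) :
    MeasurableSet[𝒜 s] (ltEvent s t) ∧ MeasurableSet[𝒜 t] (ltEvent s t) := by
  simpa using h𝒜.ltEvent_mem s t Set.univ .univ

/-- Off `{u < v}` the sections of `u` and `v` coincide, so strongness equates `m_u` and `m_v` on
that event; a nonnegative decrease with zero integral there vanishes. -/
lemma IsPosStrongSupermartingale.incr_ae_eq_indicator (hX : IsPosStrongSupermartingale P 𝒜 X)
    (h𝒜 : IsIndexedFiltration U 𝒜) {p : U × U} (hp : p.1 ≤ p.2) :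
    incr P 𝒜 X p =ᵐ[P] (ltEvent p.1 p.2).indicator (incr P 𝒜 X p) := by
  have hi := hX.supermartingale.2.2
  obtain ⟨h1, h2⟩ := h𝒜.ltEvent_measurableSet p.1 p.2
  have hm : MeasurableSet (ltEvent p.1 p.2)ᶜ := (𝒜.le _ _ h1).compl
  have h_strong := hX.strong_fintype (κ := Bool) (fun b => cond b p.1 p.2)
    (fun b => cond b ((ltEvent p.1 p.2)ᶜ.indicator 1)
      (fun ω => -(ltEvent p.1 p.2)ᶜ.indicator 1 ω))
    (by
      rintro (_ | _)
      · exact (BddMeas.indicator_one h2.compl).neg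
      · exact BddMeas.indicator_one h1.compl)
    (by
      rintro ⟨ω, i⟩
      have hsub := le_iff_subset.1 hp
      simp only [Fintype.sum_bool, cond_true, cond_false]
      by_cases hω : ω ∈ ltEvent p.1 p.2
      · simp [Set.indicator, hω]
      · have : (ω, i) ∈ toSet p.1 ↔ (ω, i) ∈ toSet p.2 :=
          ⟨fun h => by_contra fun h' => hω ⟨i, h, h'⟩, fun h => hsub h⟩
        by_cases h : (ω, i) ∈ toSet p.2 <;> simp [Set.indicator, hω, this, h])
  have h_int (u : U) : ∫ ω, (ltEvent p.1 p.2)ᶜ.indicator 1 ω * X u ω ∂P =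
      ∫ ω in (ltEvent p.1 p.2)ᶜ, X u ω ∂P := by
    rw [← integral_indicator hm]
    exact integral_congr_ae (ae_of_all _ fun ω => by simp [Set.indicator])
  simp only [Fintype.sum_bool, cond_true, cond_false, assocInt, neg_mul, integral_neg, h_int]
    at h_strong
  have h0 : ∫ ω in (ltEvent p.1 p.2)ᶜ, incr P 𝒜 X p ω ∂P = 0 := by
    simp only [incr, Pi.sub_apply]
    rw [integral_sub (hi _).integrableOn integrable_condExp.integrableOn,
      setIntegral_condExp (𝒜.le _) (hi _) h1.compl]
    linarith
  rw [setIntegral_eq_zero_iff_of_nonneg_ae (ae_restrict_of_ae (hX.incr_nonneg hp))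
    (integrable_incr hi p).integrableOn] at h0
  filter_upwards [(ae_restrict_iff' hm).1 h0] with ω hω
  by_cases h : ω ∈ ltEvent p.1 p.2
  · simp [h]
  · simpa [h] using hω h

/-- Disjointness gives `{s < t} ⊆ {s < u}`, so an event of `𝒜 s` cut by `{s < t}` is also cut by `{s
< u}` and falls into `𝒜 u`. No order between `s` and `u` is needed. -/
lemma IsIndexedFiltration.stronglyMeasurable_indicator (h𝒜 : IsIndexedFiltration U 𝒜) {s t u : U}
    (h : Disjoint (diff s t) (toSet u)) {f : Ω → ℝ} (hf : StronglyMeasurable[𝒜 s] f) :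
    StronglyMeasurable[𝒜 u] ((ltEvent s t).indicator f) := by
  have h_sub : ltEvent s t ⊆ ltEvent s u := fun ω ⟨i, hi⟩ =>
    ⟨i, hi.1, Set.disjoint_left.1 h hi⟩
  have key (F : Set Ω) (hF : MeasurableSet[𝒜 s] F) : MeasurableSet[𝒜 u] (F ∩ ltEvent s t) := by
    have := (h𝒜.ltEvent_mem s u _ (h𝒜.ltEvent_mem s t F hF).1).2
    rwa [Set.inter_assoc, Set.inter_eq_left.2 h_sub] at this
  have h_lt : MeasurableSet[𝒜 u] (ltEvent s t) := by simpa using key Set.univ .univ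
  refine Measurable.stronglyMeasurable fun B hB => ?_
  have h_eq : (ltEvent s t).indicator f ⁻¹' B =
      (f ⁻¹' B ∩ ltEvent s t) ∪ ({_ω | (0 : ℝ) ∈ B} ∩ (ltEvent s t)ᶜ) := by
    ext ω
    by_cases h : ω ∈ ltEvent s t <;> simp [h]
  rw [h_eq]
  exact (key _ (hf.measurable hB)).union (.inter (.const _) h_lt.compl)

end Incr

end SetIndexed

namespace SetIndexed

variable {Ω I : Type*} [mΩ : MeasurableSpace Ω] {P : Measure Ω}
  {U : Sublattice (Set (Ω × I))ᵒᵈ} {𝒜 : Filtration U mΩ} {X : U → Ω → ℝ}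
  {L : (DisjColl U → ℝ) → ℝ} {S : Set (Ω × I)}

/-! ### Bounds uniform in the collection, and the density of `limInt`. -/

section Bounds

lemma integral_indicator_one_mul {F : Set Ω} (hF : MeasurableSet F) (f : Ω → ℝ) :
    ∫ ω, F.indicator 1 ω * f ω ∂P = ∫ ω in F, f ω ∂P := by
  rw [← integral_indicator hF]
  exact integral_congr_ae (ae_of_all _ fun ω => by simp [Set.indicator])

lemma limInt_congr {f g : Ω → ℝ} (h : f =ᵐ[P] g) :
    limInt P 𝒜 L X S f = limInt P 𝒜 L X S g := by
  rw [limInt, limInt]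
  congr 1
  funext d
  exact integral_congr_ae (h.mono fun ω hω => by simp only [hω])

lemma IsPosStrongSupermartingale.incrSum_nonneg (hX : IsPosStrongSupermartingale P 𝒜 X)
    (S : Set (Ω × I)) (d : DisjColl U) : 0 ≤ᵐ[P] incrSum P 𝒜 X S d := by
  have : ∀ᵐ ω ∂P, ∀ p ∈ d.inside S, 0 ≤ incr P 𝒜 X p ω :=
    (ae_ball_iff (Finset.countable_toSet _)).2 fun p hp =>
      hX.incr_nonneg (d.le p (DisjColl.mem_inside.1 hp).1)
  filter_upwards [this] with ω hω
  exact Finset.sum_nonneg hω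

lemma incrSum_le (S : Set (Ω × I)) (d : DisjColl U) (ω : Ω) :
    incrSum P 𝒜 X S d ω ≤ ∑ p ∈ d.pairs, |X p.1 ω - (P[X p.2 | 𝒜 p.1]) ω| :=
  (Finset.sum_le_sum fun p _ => le_abs_self (incr P 𝒜 X p ω)).trans
    (Finset.sum_le_sum_of_subset_of_nonneg (fun _ hp => (DisjColl.mem_inside.1 hp).1)
      fun _ _ _ => abs_nonneg _)

lemma integrable_variation (hX : ∀ u, Integrable (X u) P) (d : DisjColl U) :
    Integrable (fun ω => ∑ p ∈ d.pairs, |X p.1 ω - (P[X p.2 | 𝒜 p.1]) ω|) P :=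
  integrable_finsetSum _ fun p _ => (integrable_incr hX p).abs

lemma IsUIVariation.integral_variation_le (hUI : IsUIVariation P 𝒜 X)
    (hX : ∀ u, Integrable (X u) P) :
    ∃ K, 0 ≤ K ∧ ∀ d : DisjColl U, ∑ p ∈ d.pairs, ∫ ω, |incr P 𝒜 X p ω| ∂P ≤ K := by
  obtain ⟨-, -, K, hK⟩ := hUI
  refine ⟨K, K.2, fun d => ?_⟩
  rw [← integral_finsetSum _ fun p _ => (integrable_incr hX p).abs]
  refine le_trans ?_ (integral_abs_le_of_eLpNorm_le K.2
    (integrable_variation hX d).aestronglyMeasurable ((hK d).trans (by simp)))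
  exact integral_mono (integrable_variation hX d) (integrable_variation hX d).abs
    fun ω => le_abs_self _

lemma IsUIVariation.integral_incrSum_le (hUI : IsUIVariation P 𝒜 X)
    (hX : ∀ u, Integrable (X u) P) :
    ∃ K, 0 ≤ K ∧ ∀ (S : Set (Ω × I)) (d : DisjColl U), ∫ ω, incrSum P 𝒜 X S d ω ∂P ≤ K := by
  obtain ⟨K, hK0, hK⟩ := hUI.integral_variation_le hX
  refine ⟨K, hK0, fun S d => le_trans ?_ (hK d)⟩
  rw [← integral_finsetSum _ fun p _ => (integrable_incr hX p).abs]
  exact integral_mono (integrable_incrSum hX S d) (integrable_variation hX d)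
    fun ω => incrSum_le S d ω

lemma IsUIVariation.setIntegral_incrSum_le (hUI : IsUIVariation P 𝒜 X)
    (hX : ∀ u, Integrable (X u) P) {ε : ℝ} (hε : 0 < ε) :
    ∃ δ > 0, ∀ (S : Set (Ω × I)) (d : DisjColl U) (F : Set Ω), MeasurableSet F →
      P F ≤ ENNReal.ofReal δ → ∫ ω in F, incrSum P 𝒜 X S d ω ∂P ≤ ε := by
  obtain ⟨-, h, -⟩ := hUI
  obtain ⟨δ, hδ, h⟩ := h hε
  refine ⟨δ, hδ, fun S d F hF hPF => ?_⟩
  refine le_trans ?_ (integral_abs_le_of_eLpNorm_le hε.le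
    ((integrable_variation hX d).indicator hF).aestronglyMeasurable (h d F hF hPF))
  rw [← integral_indicator hF]
  refine integral_mono ((integrable_incrSum hX S d).indicator hF)
    ((integrable_variation hX d).indicator hF).abs fun ω => ?_
  exact (Set.indicator_le_indicator (incrSum_le S d ω)).trans (le_abs_self _)

lemma IsPosStrongSupermartingale.abs_integral_mul_incrSum_le
    (hX : IsPosStrongSupermartingale P 𝒜 X) {K C : ℝ} (hC : 0 ≤ C) {g : Ω → ℝ}
    (hb : ∀ᵐ ω ∂P, |g ω| ≤ C) {d : DisjColl U} (hK : ∫ ω, incrSum P 𝒜 X S d ω ∂P ≤ K) :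
    |∫ ω, g ω * incrSum P 𝒜 X S d ω ∂P| ≤ C * K := by
  have h := norm_integral_le_of_norm_le (μ := P) (f := fun ω => g ω * incrSum P 𝒜 X S d ω)
    ((integrable_incrSum hX.supermartingale.2.2 S d).const_mul C) (by
      filter_upwards [hb, hX.incrSum_nonneg S d] with ω h1 h2
      rw [norm_mul, Real.norm_of_nonneg h2]
      exact mul_le_mul_of_nonneg_right h1 h2)
  rw [integral_const_mul] at h
  exact h.trans (mul_le_mul_of_nonneg_left hK hC)

lemma IsUIVariation.exists_bound (hUI : IsUIVariation P 𝒜 X)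
    (hX : IsPosStrongSupermartingale P 𝒜 X) {C : ℝ} (hC : 0 ≤ C) {g : Ω → ℝ}
    (hb : ∀ᵐ ω ∂P, |g ω| ≤ C) (S : Set (Ω × I)) :
    ∃ K, ∀ d : DisjColl U, |∫ ω, g ω * incrSum P 𝒜 X S d ω ∂P| ≤ K := by
  obtain ⟨K, -, hK⟩ := hUI.integral_incrSum_le hX.supermartingale.2.2
  exact ⟨C * K, fun d => hX.abs_integral_mul_incrSum_le hC hb (hK S d)⟩

lemma IsUIVariation.exists_bound_of_bddMeas (hUI : IsUIVariation P 𝒜 X)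
    (hX : IsPosStrongSupermartingale P 𝒜 X) {g : Ω → ℝ} (hg : BddMeas mΩ g) (S : Set (Ω × I)) :
    ∃ K, ∀ d : DisjColl U, |∫ ω, g ω * incrSum P 𝒜 X S d ω ∂P| ≤ K := by
  obtain ⟨C, hC, hb⟩ := hg.exists_nonneg_bound
  exact hUI.exists_bound hX hC (ae_of_all _ hb) S

lemma limInt_add (hL : IsBanachLimit L) (hUI : IsUIVariation P 𝒜 X)
    (hX : IsPosStrongSupermartingale P 𝒜 X) {f g : Ω → ℝ} (hf : BddMeas mΩ f)
    (hg : BddMeas mΩ g) :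
    limInt P 𝒜 L X S (f + g) = limInt P 𝒜 L X S f + limInt P 𝒜 L X S g := by
  rw [limInt, limInt, limInt, ← hL.add _ _ (hUI.exists_bound_of_bddMeas hX hf S)
    (hUI.exists_bound_of_bddMeas hX hg S)]
  congr 1
  funext d
  have hi := integrable_incrSum (P := P) (𝒜 := 𝒜) hX.supermartingale.2.2 S d
  rw [← integral_add (hf.integrable_mul hi) (hg.integrable_mul hi)]
  simp only [Pi.add_apply, add_mul]

lemma limInt_smul (hL : IsBanachLimit L) (hUI : IsUIVariation P 𝒜 X)
    (hX : IsPosStrongSupermartingale P 𝒜 X) (c : ℝ) {f : Ω → ℝ} (hf : BddMeas mΩ f) :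
    limInt P 𝒜 L X S (c • f) = c * limInt P 𝒜 L X S f := by
  rw [limInt, limInt, ← hL.smul _ _ (hUI.exists_bound_of_bddMeas hX hf S)]
  simp only [Pi.smul_apply, smul_eq_mul, mul_assoc, integral_const_mul]

/-- The δ of uniform integrability does not depend on `d`, so the estimate survives the Banach
limit. The representation passes from indicators to bounded `g` by sup-norm continuity. -/
lemma exists_limInt_density [IsProbabilityMeasure P] (hL : IsBanachLimit L) (hUI : IsUIVariation P 𝒜 X)
    (hX : IsPosStrongSupermartingale P 𝒜 X) (S : Set (Ω × I)) :
    ∃ h : Ω → ℝ, Integrable h P ∧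
      ∀ g, BddMeas mΩ g → limInt P 𝒜 L X S g = ∫ ω, g ω * h ω ∂P := by
  have hb {F : Set Ω} (hF : MeasurableSet F) := BddMeas.indicator_one hF
  obtain ⟨h, hi, -, h_eq⟩ := exists_density (P := P)
    (fun F => limInt P 𝒜 L X S (F.indicator 1))
    (fun F hF => by
      refine hL.nonneg _ (hUI.exists_bound_of_bddMeas hX (hb hF) S) fun d => ?_
      rw [integral_indicator_one_mul hF]
      exact integral_nonneg_of_ae (ae_restrict_of_ae (hX.incrSum_nonneg S d)))
    (fun F G hF hG hd => by
      rw [← limInt_add hL hUI hX (hb hF) (hb hG), Set.indicator_union_of_disjoint hd]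
      rfl)
    (fun ε hε => by
      obtain ⟨δ, hδ, h⟩ := hUI.setIntegral_incrSum_le hX.supermartingale.2.2 hε
      refine ⟨δ, hδ, fun F hF hPF => ?_⟩
      rw [← hL.const ε]
      refine hL.mono (hUI.exists_bound_of_bddMeas hX (hb hF) S) ⟨|ε|, fun _ => le_rfl⟩ fun d => ?_
      rw [integral_indicator_one_mul hF]
      exact h S d F hF hPF)
  refine ⟨h, hi, fun g hg => ?_⟩
  obtain ⟨K, hK0, hK⟩ := hUI.integral_incrSum_le hX.supermartingale.2.2
  refine sub_eq_zero.1 (eq_zero_of_indicator_eq_zero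
    (Ψ := fun g => limInt P 𝒜 L X S g - ∫ ω, g ω * h ω ∂P) (K := K + ∫ ω, |h ω| ∂P)
    (fun f g hf hg => ?_) (fun c f hf => ?_) (fun f C hf hC => ?_) (fun F hF => ?_) hg)
  · rw [limInt_add hL hUI hX hf hg]
    simp only [Pi.add_apply, add_mul]
    rw [integral_add (hf.integrable_mul hi) (hg.integrable_mul hi)]
    ring
  · rw [limInt_smul hL hUI hX c hf]
    simp only [Pi.smul_apply, smul_eq_mul, mul_assoc, integral_const_mul]
    ring
  · obtain ⟨ω₀⟩ : Nonempty Ω := P.nonempty_of_neZero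
    have hC0 : 0 ≤ C := (abs_nonneg _).trans (hC ω₀)
    refine (abs_sub _ _).trans ?_
    rw [mul_add]
    refine add_le_add (hL.abs_le fun d =>
      hX.abs_integral_mul_incrSum_le hC0 (ae_of_all _ hC) (hK S d)) ?_
    rw [← integral_const_mul, ← Real.norm_eq_abs]
    refine norm_integral_le_of_norm_le (hi.abs.const_mul C) (ae_of_all _ fun ω => ?_)
    rw [norm_mul]
    exact mul_le_mul_of_nonneg_right (hC ω) (abs_nonneg _)
  · rw [h_eq F hF, integral_indicator_one_mul hF, sub_self]

end Bounds

/-! ### The compensator and its properties. -/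

section Compensator

variable [IsProbabilityMeasure P]

/-- A density of `limInt` over `S`. -/
noncomputable def limDensity (hL : IsBanachLimit L) (hUI : IsUIVariation P 𝒜 X)
    (hX : IsPosStrongSupermartingale P 𝒜 X) (S : Set (Ω × I)) : Ω → ℝ :=
  (exists_limInt_density hL hUI hX S).choose

/-- The adapted version of the compensator of `X` along the Banach limit. -/
noncomputable def compensator (hL : IsBanachLimit L) (hUI : IsUIVariation P 𝒜 X)
    (hX : IsPosStrongSupermartingale P 𝒜 X) (u : U) : Ω → ℝ :=
  P[limDensity hL hUI hX (toSet u)ᶜ | 𝒜 u]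

variable (hL : IsBanachLimit L) (hUI : IsUIVariation P 𝒜 X)
    (hX : IsPosStrongSupermartingale P 𝒜 X)

lemma integrable_limDensity (S : Set (Ω × I)) : Integrable (limDensity hL hUI hX S) P :=
  (exists_limInt_density hL hUI hX S).choose_spec.1

lemma limInt_eq_limDensity (S : Set (Ω × I)) {g : Ω → ℝ} (hg : BddMeas mΩ g) :
    limInt P 𝒜 L X S g = ∫ ω, g ω * limDensity hL hUI hX S ω ∂P :=
  (exists_limInt_density hL hUI hX S).choose_spec.2 g hg

-- The projection can be moved from `g` to each decrease. A member inside `uᶜ` is disjoint from `u`,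
-- so its decrease agrees almost surely with an `𝒜 u`-measurable function and is left unchanged.
include hX in
lemma limInt_condExp (h𝒜 : IsIndexedFiltration U 𝒜) (u : U) {g : Ω → ℝ} (hg : BddMeas mΩ g) :
    limInt P 𝒜 L X (toSet u)ᶜ (P[g | 𝒜 u]) = limInt P 𝒜 L X (toSet u)ᶜ g := by
  have hi := integrable_incr (P := P) (𝒜 := 𝒜) hX.supermartingale.2.2
  obtain ⟨C, -, hC⟩ := hg.exists_nonneg_bound
  rw [limInt, limInt]
  congr 1
  funext d
  simp only [incrSum, Finset.mul_sum]
  rw [integral_finsetSum _ fun p _ => hg.integrable_mul (hi p),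
    integral_finsetSum _ fun p _ => integrable_mul_of_bdd
      (stronglyMeasurable_condExp.mono (𝒜.le u)).aestronglyMeasurable
      (abs_condExp_le (ae_of_all _ hC)) (hi p)]
  refine Finset.sum_congr rfl fun p hp => ?_
  obtain ⟨hpd, hsub, -⟩ := DisjColl.mem_inside.1 hp
  have h_ae := hX.incr_ae_eq_indicator h𝒜 (d.le p hpd)
  have h_meas := h𝒜.stronglyMeasurable_indicator (Set.disjoint_left.2 fun x hx => hsub hx)
    (stronglyMeasurable_incr (P := P) hX.supermartingale.1 p)
  rw [integral_condExp_mul (𝒜.le u) hg.aestronglyMeasurable (ae_of_all _ hC) (hi p)]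
  refine integral_congr_ae ?_
  have : P[incr P 𝒜 X p | 𝒜 u] =ᵐ[P] incr P 𝒜 X p := by
    refine (condExp_congr_ae h_ae).trans ?_
    rw [condExp_of_stronglyMeasurable (𝒜.le u) h_meas ((hi p).congr h_ae)]
    exact h_ae.symm
  filter_upwards [this] with ω hω
  rw [hω]

lemma limInt_eq_compensator (h𝒜 : IsIndexedFiltration U 𝒜) (u : U) {g : Ω → ℝ}
    (hg : BddMeas mΩ g) :
    limInt P 𝒜 L X (toSet u)ᶜ g = ∫ ω, g ω * compensator hL hUI hX u ω ∂P := by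
  obtain ⟨C, hC0, hC⟩ := hg.exists_nonneg_bound
  obtain ⟨g', hg', h_ae⟩ := exists_bddMeas_ae_eq (P := P) hC0
    (stronglyMeasurable_condExp.mono (𝒜.le u)).aestronglyMeasurable
    (abs_condExp_le (m := 𝒜 u) (ae_of_all P hC))
  rw [compensator, ← integral_condExp_mul (𝒜.le u) hg.aestronglyMeasurable (ae_of_all _ hC)
    (integrable_limDensity hL hUI hX _), ← limInt_condExp hX h𝒜 u hg, limInt_congr h_ae,
    limInt_eq_limDensity hL hUI hX _ hg']
  exact integral_congr_ae (h_ae.mono fun ω hω => by simp only [hω])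

lemma integrable_compensator (u : U) : Integrable (compensator hL hUI hX u) P :=
  integrable_condExp

omit [IsProbabilityMeasure P] in
include hL hUI hX in
lemma limInt_compl_eq_add {u v : U} (huv : u ≤ v) {g : Ω → ℝ} (hg : BddMeas mΩ g) :
    limInt P 𝒜 L X (toSet v)ᶜ g = limInt P 𝒜 L X (toSet u)ᶜ g + limInt P 𝒜 L X (diff u v) g := by
  classical
  have hb (S : Set (Ω × I)) := hUI.exists_bound_of_bddMeas hX hg S
  have hi := fun S d => integrable_incrSum (P := P) (𝒜 := 𝒜) hX.supermartingale.2.2 S d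
  rw [limInt, limInt, limInt, ← hL.add _ _ (hb _) (hb _)]
  refine hL.congr (hb _) ?_ ?_
  · obtain ⟨C, hC⟩ := hb (toSet u)ᶜ
    obtain ⟨C', hC'⟩ := hb (diff u v)
    exact ⟨C + C', fun d => (abs_add_le _ _).trans (add_le_add (hC d) (hC' d))⟩
  -- Once `d` refines `u ∩ vᶜ`, no member straddles its boundary: those inside `vᶜ` split into those
  -- inside `uᶜ` and those inside `u ∩ vᶜ`.
  filter_upwards [eventually_ge_atTop (DisjColl.single (u, v) huv)] with d hd
  rw [← integral_add (hg.integrable_mul (hi _ d)) (hg.integrable_mul (hi _ d))]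
  refine integral_congr_ae (ae_of_all _ fun ω => ?_)
  have hvu := le_iff_subset.1 huv
  have h_disj : Disjoint (d.inside (toSet u)ᶜ) (d.inside (diff u v)) := by
    rw [Finset.disjoint_left]
    intro p hp hp'
    obtain ⟨-, h1, x, hx⟩ := DisjColl.mem_inside.1 hp
    exact h1 hx ((DisjColl.mem_inside.1 hp').2.1 hx).1
  have h_union : d.inside (toSet v)ᶜ = d.inside (toSet u)ᶜ ∪ d.inside (diff u v) := by
    ext p
    simp only [Finset.mem_union, DisjColl.mem_inside]
    constructor
    · rintro ⟨hpd, hsub, hne⟩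
      rcases DisjColl.subset_or_disjoint hd (Finset.mem_singleton_self (u, v)) hpd with h | h
      · exact .inr ⟨hpd, h, hne⟩
      · exact .inl ⟨hpd, fun x hx hxu => Set.disjoint_left.1 h hx ⟨hxu, hsub hx⟩, hne⟩
    · rintro (⟨hpd, hsub, hne⟩ | ⟨hpd, hsub, hne⟩)
      · exact ⟨hpd, hsub.trans (Set.compl_subset_compl.2 hvu), hne⟩
      · exact ⟨hpd, fun x hx => (hsub hx).2, hne⟩
  simp only [incrSum]
  rw [h_union, Finset.sum_union h_disj, mul_add]

lemma limInt_diff_eq_compensator (h𝒜 : IsIndexedFiltration U 𝒜) {u v : U} (huv : u ≤ v)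
    {g : Ω → ℝ} (hg : BddMeas mΩ g) :
    limInt P 𝒜 L X (diff u v) g =
      ∫ ω, g ω * (compensator hL hUI hX v ω - compensator hL hUI hX u ω) ∂P := by
  simp only [mul_sub]
  rw [integral_sub (hg.integrable_mul (integrable_compensator hL hUI hX v))
    (hg.integrable_mul (integrable_compensator hL hUI hX u)),
    ← limInt_eq_compensator hL hUI hX h𝒜 v hg, ← limInt_eq_compensator hL hUI hX h𝒜 u hg,
    limInt_compl_eq_add hL hUI hX huv hg]
  ring

lemma compensator_mono (h𝒜 : IsIndexedFiltration U 𝒜) {u v : U} (huv : u ≤ v) :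
    compensator hL hUI hX u ≤ᵐ[P] compensator hL hUI hX v := by
  have hi := fun u => integrable_compensator hL hUI hX u
  have : 0 ≤ᵐ[P] compensator hL hUI hX v - compensator hL hUI hX u := by
    refine ae_nonneg_of_forall_setIntegral_nonneg ((hi v).sub (hi u)) fun F hF _ => ?_
    rw [← integral_indicator_one_mul hF]
    have hb := BddMeas.indicator_one hF
    refine le_of_le_of_eq ?_ (limInt_diff_eq_compensator hL hUI hX h𝒜 huv hb)
    refine hL.nonneg _ (hUI.exists_bound_of_bddMeas hX hb _) fun d => ?_
    rw [integral_indicator_one_mul hF]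
    exact integral_nonneg_of_ae (ae_restrict_of_ae (hX.incrSum_nonneg _ d))
  filter_upwards [this] with ω hω
  simpa using hω

lemma compensator_eq_zero (h𝒜 : IsIndexedFiltration U 𝒜) {u : U} (hu : toSet u = Set.univ) :
    compensator hL hUI hX u =ᵐ[P] 0 := by
  refine (integrable_compensator hL hUI hX u).ae_eq_zero_of_forall_setIntegral_eq_zero
    fun F hF _ => ?_
  rw [← integral_indicator_one_mul hF,
    ← limInt_eq_compensator hL hUI hX h𝒜 u (BddMeas.indicator_one hF), hu]
  refine hL.eventually_const (hUI.exists_bound_of_bddMeas hX (BddMeas.indicator_one hF) _)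
    (Eventually.of_forall fun d => ?_)
  have : d.inside (∅ : Set (Ω × I)) = ∅ := by
    refine Finset.eq_empty_of_forall_notMem fun p hp => ?_
    obtain ⟨-, h, x, hx⟩ := DisjColl.mem_inside.1 hp
    exact h hx
  simp [incrSum, this]

-- Strongness applied to `1_F (1_u - 1_v) - ∑ 1_F (1_{p.1} - 1_{p.2}) = 0`, the sum being over the
-- members inside `u ∩ vᶜ`. Refinement ensures `u ≤ p.1`, so `F` is measurable for every σ-algebra
-- involved.
include hX in
lemma integral_indicator_mul_incrSum {u v : U} (huv : u ≤ v) {d : DisjColl U}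
    (hd : DisjColl.single (u, v) huv ≤ d) {F : Set Ω} (hF : MeasurableSet[𝒜 u] F) :
    ∫ ω, F.indicator 1 ω * incrSum P 𝒜 X (diff u v) d ω ∂P = assoc P X u F - assoc P X v F := by
  have hi := hX.supermartingale.2.2
  have hF' := 𝒜.le u F hF
  have h_le (p : d.inside (diff u v)) : u ≤ p.1.1 := DisjColl.le_of_mem_inside huv hd p.2
  have h_le' (p : d.inside (diff u v)) : p.1.1 ≤ p.1.2 := d.le _ (DisjColl.mem_inside.1 p.2).1
  have h_ind (v : U) (hv : u ≤ v) : BddMeas (𝒜 v) (F.indicator (1 : Ω → ℝ)) :=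
    BddMeas.indicator_one (𝒜.mono hv F hF)
  let κ := (Bool ⊕ (d.inside (diff u v) ⊕ d.inside (diff u v)))
  let t : κ → U := Sum.elim (fun b => cond b u v) (Sum.elim (fun p => p.1.1) (fun p => p.1.2))
  let f : κ → Ω → ℝ := Sum.elim (fun b => cond b (F.indicator 1) (fun ω => -F.indicator 1 ω))
    (Sum.elim (fun _ ω => -F.indicator 1 ω) (fun _ => F.indicator 1))
  have h_strong := hX.strong_fintype t f (by
      rintro ((_ | _) | p | p)
      · exact (h_ind v huv).neg
      · exact h_ind u le_rfl
      · exact (h_ind _ (h_le p)).neg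
      · exact h_ind _ ((h_le p).trans (h_le' p)))
    (by
      intro x
      have h := DisjColl.sum_indicator_inside huv hd (fun y => F.indicator 1 y.1) x
      rw [indicator_diff huv, ← Finset.sum_coe_sort] at h
      simp_rw [fun p : d.inside (diff u v) => indicator_diff (h_le' p)] at h
      have h_neg (S : Set (Ω × I)) : S.indicator (fun y => -F.indicator (1 : Ω → ℝ) y.1) x =
          -S.indicator (fun y => F.indicator (1 : Ω → ℝ) y.1) x :=
        congrFun (Set.indicator_neg S _) x
      simp only [κ, t, f, Fintype.sum_sum_type, Sum.elim_inl, Sum.elim_inr, Fintype.sum_bool,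
        cond_true, cond_false, h_neg]
      rw [Finset.sum_sub_distrib] at h
      rw [Finset.sum_neg_distrib]
      linarith)
  simp only [κ, t, f, Fintype.sum_sum_type, Sum.elim_inl, Sum.elim_inr, Fintype.sum_bool,
    cond_true, cond_false, assocInt, neg_mul, integral_neg, integral_indicator_one_mul hF',
    Finset.sum_neg_distrib] at h_strong
  rw [integral_indicator_one_mul hF']
  simp only [incrSum]
  rw [integral_finsetSum _ fun p _ => (integrable_incr hi p).integrableOn, ← Finset.sum_coe_sort]
  have h_p (p : d.inside (diff u v)) : ∫ ω in F, incr P 𝒜 X p ω ∂P =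
      ∫ ω in F, X p.1.1 ω ∂P - ∫ ω in F, X p.1.2 ω ∂P := by
    simp only [incr, Pi.sub_apply]
    rw [integral_sub (hi _).integrableOn integrable_condExp.integrableOn,
      setIntegral_condExp (𝒜.le _) (hi _) (𝒜.mono (h_le p) F hF)]
  simp only [h_p, Finset.sum_sub_distrib, assoc]
  linarith

omit [IsProbabilityMeasure P] in
include hX in
lemma assoc_eq_zero_of_toSet_eq_empty {v : U} (hv : toSet v = ∅) {F : Set Ω}
    (hF : MeasurableSet[𝒜 v] F) : assoc P X v F = 0 := by
  have := hX.strong_fintype (κ := Unit) (fun _ => v) (fun _ => F.indicator 1)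
    (fun _ => BddMeas.indicator_one hF) (fun x => by simp [hv])
  simpa [assocInt, assoc, integral_indicator_one_mul (𝒜.le v F hF)] using this

lemma compensator_decomp (h𝒜 : IsIndexedFiltration U 𝒜) {v : U} (hv : toSet v = ∅) (u : U)
    {F : Set Ω} (hF : MeasurableSet[𝒜 u] F) :
    assoc P X u F = ∫ ω in F, (compensator hL hUI hX v ω - compensator hL hUI hX u ω) ∂P := by
  have huv : u ≤ v := le_iff_subset.2 (by simp [hv])
  have hF' := 𝒜.le u F hF
  have hb := BddMeas.indicator_one hF'
  rw [← integral_indicator_one_mul hF', ← limInt_diff_eq_compensator hL hUI hX h𝒜 huv hb]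
  refine (hL.eventually_const (hUI.exists_bound_of_bddMeas hX hb _) ?_).symm
  filter_upwards [eventually_ge_atTop (DisjColl.single (u, v) huv)] with d hd
  rw [integral_indicator_mul_incrSum hX huv hd hF,
    assoc_eq_zero_of_toSet_eq_empty hX hv (𝒜.mono huv F hF), sub_zero]

end Compensator

end SetIndexed

namespace SetIndexed

/-! ### Elementary processes, predictable approximations and the conclusion. -/

section SimpleProc

variable {Ω I : Type*} {U : Sublattice (Set (Ω × I))ᵒᵈ}

lemma simpleProc_eq_of_mem {d : DisjColl U} (g : U × U → Ω → ℝ) {p : U × U} (hp : p ∈ d.pairs)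
    {x : Ω × I} (hx : x ∈ diff p.1 p.2) : simpleProc d g x = g p x.1 := by
  rw [simpleProc, Finset.sum_eq_single_of_mem p hp, Set.indicator_of_mem hx]
  exact fun q hq hne => Set.indicator_of_notMem
    (fun hxq => Set.disjoint_left.1 (d.disj q hq p hp hne) hxq hx) _

lemma simpleProc_eq_zero {d : DisjColl U} (g : U × U → Ω → ℝ) {x : Ω × I}
    (hx : ∀ p ∈ d.pairs, x ∉ diff p.1 p.2) : simpleProc d g x = 0 :=
  Finset.sum_eq_zero fun p hp => Set.indicator_of_notMem (hx p hp) _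

lemma exists_abs_simpleProc_le (d : DisjColl U) (g : U × U → Ω → ℝ)
    (hg : ∀ p ∈ d.pairs, ∃ C, ∀ ω, |g p ω| ≤ C) :
    ∃ C, 0 ≤ C ∧ ∀ x, |simpleProc d g x| ≤ C := by
  choose! C hC using hg
  have h_nonneg : ∀ p ∈ d.pairs, 0 ≤ |C p| := fun p _ => abs_nonneg _
  refine ⟨∑ p ∈ d.pairs, |C p|, Finset.sum_nonneg h_nonneg, fun x => ?_⟩
  by_cases h : ∃ p ∈ d.pairs, x ∈ diff p.1 p.2
  · obtain ⟨p, hp, hx⟩ := h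
    rw [simpleProc_eq_of_mem g hp hx]
    exact ((hC p hp x.1).trans (le_abs_self _)).trans (Finset.single_le_sum h_nonneg hp)
  · push Not at h
    rw [simpleProc_eq_zero g h, abs_zero]
    exact Finset.sum_nonneg h_nonneg

lemma abs_iInf_le {ι : Type*} {f : ι → ℝ} {C : ℝ} (hC : 0 ≤ C) (h : ∀ i, |f i| ≤ C) :
    |⨅ i, f i| ≤ C := by
  rcases isEmpty_or_nonempty ι with _ | ⟨⟨i⟩⟩
  · simpa [Real.iInf_of_isEmpty] using hC
  · have : Nonempty ι := ⟨i⟩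
    have hb : BddBelow (Set.range f) := ⟨-C, by rintro _ ⟨j, rfl⟩; exact (abs_le.1 (h j)).1⟩
    exact abs_le.2 ⟨le_ciInf fun j => (abs_le.1 (h j)).1,
      (ciInf_le hb i).trans (abs_le.1 (h i)).2⟩

end SimpleProc

variable {Ω I : Type*} [mΩ : MeasurableSpace Ω] {P : Measure Ω}
  {U : Sublattice (Set (Ω × I))ᵒᵈ} {𝒜 : Filtration U mΩ} {X A : U → Ω → ℝ} {M : Ω → ℝ}
  {L : (DisjColl U → ℝ) → ℝ}

lemma abs_predCoef_le {b : Ω × I → ℝ} {C : ℝ} (hC : 0 ≤ C) (hb : ∀ x, |b x| ≤ C) (p : U × U) :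
    ∀ᵐ ω ∂P, |predCoef P 𝒜 b p ω| ≤ C :=
  abs_condExp_le (ae_of_all _ fun _ => abs_iInf_le hC fun _ => hb _)

lemma aestronglyMeasurable_predCoef (b : Ω × I → ℝ) (p : U × U) :
    AEStronglyMeasurable (predCoef P 𝒜 b p) P :=
  (stronglyMeasurable_condExp.mono (𝒜.le _)).aestronglyMeasurable

lemma predCoef_eq_zero {b : Ω × I → ℝ} {p : U × U} (hb : ∀ x ∈ diff p.1 p.2, b x = 0) :
    predCoef P 𝒜 b p = 0 := by
  have : (fun ω => ⨅ i : {i : I // (ω, i) ∈ diff p.1 p.2}, b (ω, i)) = 0 := by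
    funext ω
    rcases isEmpty_or_nonempty {i : I // (ω, i) ∈ diff p.1 p.2} with _ | _
    · simp [Real.iInf_of_isEmpty]
    · simp only [fun i : {i : I // (ω, i) ∈ diff p.1 p.2} => hb _ i.2, ciInf_const, Pi.zero_apply]
  rw [predCoef, this, condExp_zero]

lemma predCoef_eq_indicator {b : Ω × I → ℝ} {p : U × U} {f : Ω → ℝ}
    (hb : ∀ x ∈ diff p.1 p.2, b x = f x.1) :
    predCoef P 𝒜 b p = P[(ltEvent p.1 p.2).indicator f | 𝒜 p.1] := by
  have : (fun ω => ⨅ i : {i : I // (ω, i) ∈ diff p.1 p.2}, b (ω, i)) =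
      (ltEvent p.1 p.2).indicator f := by
    funext ω
    by_cases h : ω ∈ ltEvent p.1 p.2
    · obtain ⟨i, hi⟩ := id h
      have : Nonempty {i : I // (ω, i) ∈ diff p.1 p.2} := ⟨i, hi⟩
      simp only [fun i : {i : I // (ω, i) ∈ diff p.1 p.2} => hb _ i.2, ciInf_const,
        Set.indicator_of_mem h]
    · have : IsEmpty {i : I // (ω, i) ∈ diff p.1 p.2} := ⟨fun i => h ⟨i.1, i.2⟩⟩
      rw [Real.iInf_of_isEmpty, Set.indicator_of_notMem h]
  rw [predCoef, this]

variable [IsProbabilityMeasure P]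

/-- The decomposition says `X_u = P(M | 𝒜_u) - A_u` almost surely, and the martingale part cancels
in the decrease. -/
lemma incr_ae_eq_of_decomp (hX : StronglyAdapted 𝒜 X) (hXi : ∀ u, Integrable (X u) P)
    (hM : Integrable M P) (hAi : ∀ u, Integrable (A u) P) (hA : StronglyAdapted 𝒜 A)
    (h : ∀ (u : U) (F : Set Ω), MeasurableSet[𝒜 u] F →
      assoc P X u F = ∫ ω in F, (M ω - A u ω) ∂P) {p : U × U} (hp : p.1 ≤ p.2) :
    incr P 𝒜 X p =ᵐ[P] P[A p.2 | 𝒜 p.1] - A p.1 := by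
  have hX_eq (u : U) : X u =ᵐ[P] P[M | 𝒜 u] - A u := by
    have h1 : X u =ᵐ[P] P[M - A u | 𝒜 u] :=
      ae_eq_condExp_of_forall_setIntegral_eq (𝒜.le u) (hM.sub (hAi u))
        (fun F _ _ => (hXi u).integrableOn) (fun F hF _ => h u F hF)
        (hX u).aestronglyMeasurable
    have h2 := condExp_sub hM (hAi u) (𝒜 u)
    rw [condExp_of_stronglyMeasurable (𝒜.le u) (hA u) (hAi u)] at h2
    exact h1.trans h2
  have h1 := condExp_congr_ae (m := 𝒜 p.1) (hX_eq p.2)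
  have h2 := condExp_sub (integrable_condExp (m := 𝒜 p.2) (f := M) (μ := P)) (hAi p.2) (𝒜 p.1)
  have h3 := condExp_condExp_of_le (μ := P) (f := M) (𝒜.mono hp) (𝒜.le p.2)
  filter_upwards [h1, h2, h3, hX_eq p.1] with ω h1 h2 h3 h4
  simp only [incr, Pi.sub_apply] at *
  rw [h1, h2, h3, h4]
  ring

omit [IsProbabilityMeasure P] in
lemma isUIVariation_iff_of_incr_ae_eq
    (h : ∀ p : U × U, p.1 ≤ p.2 → incr P 𝒜 X p =ᵐ[P] P[A p.2 | 𝒜 p.1] - A p.1) :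
    IsUIVariation P 𝒜 X ↔ IsUIVariation P 𝒜 A := by
  have key (d : DisjColl U) : (fun ω => ∑ p ∈ d.pairs, |X p.1 ω - (P[X p.2 | 𝒜 p.1]) ω|) =ᵐ[P]
      fun ω => ∑ p ∈ d.pairs, |A p.1 ω - (P[A p.2 | 𝒜 p.1]) ω| := by
    have : ∀ᵐ ω ∂P, ∀ p ∈ d.pairs, incr P 𝒜 X p ω = (P[A p.2 | 𝒜 p.1] - A p.1) ω :=
      (ae_ball_iff (Finset.countable_toSet _)).2 fun p hp => h p (d.le p hp)
    filter_upwards [this] with ω hω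
    refine Finset.sum_congr rfl fun p hp => ?_
    have := hω p hp
    simp only [incr, Pi.sub_apply] at this
    rw [this, abs_sub_comm]
  exact ⟨fun h => h.ae_eq key, fun h => h.ae_eq fun d => (key d).symm⟩

/-- The coefficients are `𝒜 p.1`-measurable, so `A p.2` may be replaced by its conditional
expectation. The right side no longer involves `A`. -/
lemma meanInt_predCoef (hAi : ∀ u, Integrable (A u) P)
    (h : ∀ p : U × U, p.1 ≤ p.2 → incr P 𝒜 X p =ᵐ[P] P[A p.2 | 𝒜 p.1] - A p.1)
    {b : Ω × I → ℝ} {C : ℝ} (hC : 0 ≤ C) (hb : ∀ x, |b x| ≤ C) (d : DisjColl U) :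
    meanInt P A d (predCoef P 𝒜 b) =
      ∑ p ∈ d.pairs, ∫ ω, predCoef P 𝒜 b p ω * incr P 𝒜 X p ω ∂P := by
  have hi {f : Ω → ℝ} (p : U × U) (hf : Integrable f P) :
      Integrable (fun ω => predCoef P 𝒜 b p ω * f ω) P :=
    integrable_mul_of_bdd (aestronglyMeasurable_predCoef b p) (abs_predCoef_le hC hb p) hf
  have hi_sub (p : U × U) := hi p ((hAi p.2).sub (hAi p.1))
  simp only [Pi.sub_apply] at hi_sub
  rw [meanInt, integral_finsetSum _ fun p _ => hi_sub p]
  refine Finset.sum_congr rfl fun p hp => ?_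
  have h1 : ∫ ω, predCoef P 𝒜 b p ω * incr P 𝒜 X p ω ∂P =
      ∫ ω, predCoef P 𝒜 b p ω * ((P[A p.2 | 𝒜 p.1]) ω - A p.1 ω) ∂P :=
    integral_congr_ae ((h p (d.le p hp)).mono fun ω hω => by simp only [hω, Pi.sub_apply])
  rw [h1]
  simp only [mul_sub]
  rw [integral_sub (hi p (hAi _)) (hi p (hAi _)), integral_sub (hi p integrable_condExp)
    (hi p (hAi _)),
    integral_mul_condExp (g := predCoef P 𝒜 b p) (𝒜.le _) stronglyMeasurable_condExp
      (hi p (hAi _)) (hAi _)]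

-- A nonempty `r` of the refinement lies in exactly one `p` of `d₀`, or the process vanishes on it.
-- In the first case the infimum equals `g p` on `{r.1 < r.2}`, which carries the decrease, and the
-- conditioning is absorbed by the measurable decrease.
open Classical in
lemma integral_predCoef_mul_incr (h𝒜 : IsIndexedFiltration U 𝒜)
    (hX : IsPosStrongSupermartingale P 𝒜 X) {d₀ d : DisjColl U} (hd : d₀ ≤ d)
    {g : U × U → Ω → ℝ} (hg : ∀ p ∈ d₀.pairs, BddMeas mΩ (g p)) {r : U × U} (hr : r ∈ d.pairs) :
    ∫ ω, predCoef P 𝒜 (simpleProc d₀ g) r ω * incr P 𝒜 X r ω ∂P =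
      ∑ p ∈ d₀.pairs, if diff r.1 r.2 ⊆ diff p.1 p.2 ∧ (diff r.1 r.2).Nonempty then
        ∫ ω, g p ω * incr P 𝒜 X r ω ∂P else 0 := by
  have hi := integrable_incr (P := P) (𝒜 := 𝒜) hX.supermartingale.2.2 r
  by_cases h : ∃ p ∈ d₀.pairs, diff r.1 r.2 ⊆ diff p.1 p.2 ∧ (diff r.1 r.2).Nonempty
  · obtain ⟨p, hp, hsub, hne⟩ := h
    obtain ⟨C, hC0, hC⟩ := (hg p hp).exists_nonneg_bound
    rw [Finset.sum_eq_single_of_mem p hp, if_pos ⟨hsub, hne⟩,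
      predCoef_eq_indicator (f := g p) fun x hx => simpleProc_eq_of_mem g hp (hsub hx),
      integral_condExp_mul (𝒜.le _)
        ((hg p hp).1.indicator
          (𝒜.le _ _ (h𝒜.ltEvent_measurableSet r.1 r.2).1)).aestronglyMeasurable
        (C := C) (ae_of_all _ fun ω => ?_) hi,
      condExp_of_stronglyMeasurable (𝒜.le _) (stronglyMeasurable_incr hX.supermartingale.1 r) hi]
    · refine integral_congr_ae ((hX.incr_ae_eq_indicator h𝒜 (d.le r hr)).mono fun ω hω => ?_)
      by_cases hlt : ω ∈ ltEvent r.1 r.2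
      · simp [hlt]
      · rw [Set.indicator_of_notMem hlt] at hω
        simp [hω]
    · by_cases hlt : ω ∈ ltEvent r.1 r.2
      · simpa [hlt] using hC ω
      · simpa [hlt] using hC0
    · intro q hq hqp
      obtain ⟨x, hx⟩ := hne
      exact if_neg fun h => Set.disjoint_left.1 (d₀.disj q hq p hp hqp) (h.1 hx) (hsub hx)
  · push Not at h
    rw [predCoef_eq_zero, Finset.sum_eq_zero fun p hp => if_neg fun h' => ?_]
    · simp
    · exact h'.2.ne_empty (h p hp h'.1)
    · intro x hx
      refine simpleProc_eq_zero g fun p hp hxp => ?_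
      rcases DisjColl.subset_or_disjoint hd hp hr with h' | h'
      · exact (Set.nonempty_of_mem hx).ne_empty (h p hp h')
      · exact Set.disjoint_left.1 h' hx hxp

lemma isDoobMeyer_compensator (h𝒜 : IsIndexedFiltration U 𝒜) (hL : IsBanachLimit L)
    (hUI : IsUIVariation P 𝒜 X) (hX : IsPosStrongSupermartingale P 𝒜 X) {v : U}
    (hv : toSet v = ∅) :
    IsDoobMeyer P 𝒜 L X (compensator hL hUI hX v) (compensator hL hUI hX) := by
  classical
  have hAi := integrable_compensator hL hUI hX
  have hA : StronglyAdapted 𝒜 (compensator hL hUI hX) := fun u => stronglyMeasurable_condExp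
  have h_decomp (u : U) (F : Set Ω) (hF : MeasurableSet[𝒜 u] F) :=
    compensator_decomp hL hUI hX h𝒜 hv u hF
  refine ⟨hAi v, hAi, hA, fun u hu => compensator_eq_zero hL hUI hX h𝒜 hu,
    fun u v huv => compensator_mono hL hUI hX h𝒜 huv, h_decomp, fun d₀ g hg => ?_⟩
  obtain ⟨C, hC0, hC⟩ := exists_abs_simpleProc_le d₀ g fun p hp => (hg p hp).2
  have hXi := hX.supermartingale.2.2
  have h_mean := meanInt_predCoef hAi (fun p hp => incr_ae_eq_of_decomp hX.supermartingale.1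
    hXi (hAi v) hAi hA h_decomp hp) hC0 hC
  obtain ⟨h_bdd, h_sum⟩ := hL.sum d₀.pairs
    (fun p d => ∫ ω, g p ω * incrSum P 𝒜 X (diff p.1 p.2) d ω ∂P)
    fun p hp => hUI.exists_bound_of_bddMeas hX (hg p hp) _
  have h_left : meanInt P (compensator hL hUI hX) d₀ g =
      L fun d => ∑ p ∈ d₀.pairs, ∫ ω, g p ω * incrSum P 𝒜 X (diff p.1 p.2) d ω ∂P := by
    have hi_sub (p : U × U) (hp : p ∈ d₀.pairs) :=
      (hg p hp).integrable_mul ((hAi p.2).sub (hAi p.1))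
    simp only [Pi.sub_apply] at hi_sub
    rw [h_sum, meanInt, integral_finsetSum _ hi_sub]
    exact Finset.sum_congr rfl fun p hp =>
      (limInt_diff_eq_compensator hL hUI hX h𝒜 (d₀.le p hp) (hg p hp)).symm
  rw [h_left]
  refine hL.congr h_bdd ?_ ?_
  -- Eventual equality of nets determines the Banach limit only if both are bounded; here the bound
  -- is the sup of the process times the uniform bound on the mean variation.
  · obtain ⟨K, -, hK⟩ := hUI.integral_variation_le hXi
    refine ⟨C * K, fun d => ?_⟩
    rw [h_mean]
    refine (Finset.abs_sum_le_sum_abs _ _).trans ?_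
    refine le_trans (Finset.sum_le_sum fun p _ => ?_)
      ((Finset.mul_sum _ _ _).symm.le.trans (mul_le_mul_of_nonneg_left (hK d) hC0))
    rw [← integral_const_mul, ← Real.norm_eq_abs]
    refine norm_integral_le_of_norm_le ((integrable_incr hXi p).abs.const_mul C) ?_
    filter_upwards [abs_predCoef_le hC0 hC p] with ω hω
    rw [norm_mul]
    exact mul_le_mul_of_nonneg_right hω (abs_nonneg _)
  filter_upwards [eventually_ge_atTop d₀] with d hd
  rw [h_mean, Finset.sum_congr rfl fun r hr => integral_predCoef_mul_incr h𝒜 hX hd hg hr,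
    Finset.sum_comm]
  refine Finset.sum_congr rfl fun p hp => ?_
  rw [← Finset.sum_filter]
  simp only [incrSum, Finset.mul_sum]
  rw [integral_finsetSum _ fun r _ => (hg p hp).integrable_mul (integrable_incr hXi r)]
  rfl

lemma IsDoobMeyer.ae_eq (h𝒜 : IsIndexedFiltration U 𝒜) (hX : StronglyAdapted 𝒜 X)
    (hXi : ∀ u, Integrable (X u) P) {N : Ω → ℝ} {B : U → Ω → ℝ}
    (hA : IsDoobMeyer P 𝒜 L X M A) (hB : IsDoobMeyer P 𝒜 L X N B) :
    M =ᵐ[P] N ∧ ∀ u, A u =ᵐ[P] B u := by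
  have h_process (u : U) : A u =ᵐ[P] B u := by
    -- Condition 3 is tested on `1_F` times the indicator of `o ∩ uᶜ`; as both processes vanish at
    -- `o`, its left side is the integral over `F` of the process at `u`.
    let o : U := ⟨_, h𝒜.univ_mem⟩
    have ho : toSet o = Set.univ := rfl
    have hou : o ≤ u := le_iff_subset.2 (Set.subset_univ _)
    refine (hA.integrable_A u).ae_eq_of_forall_setIntegral_eq _ _ (hB.integrable_A u)
      fun F hF _ => ?_
    have hg : ∀ p ∈ (DisjColl.single (o, u) hou).pairs, BddMeas mΩ (F.indicator (1 : Ω → ℝ)) :=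
      fun _ _ => BddMeas.indicator_one hF
    obtain ⟨C, hC0, hC⟩ := exists_abs_simpleProc_le (DisjColl.single (o, u) hou)
      (fun _ => F.indicator 1) fun p hp => (hg p hp).2
    have h_mean {M' : Ω → ℝ} {A' : U → Ω → ℝ} (h : IsDoobMeyer P 𝒜 L X M' A') :
        ∫ ω in F, A' u ω ∂P = L fun d => ∑ p ∈ d.pairs,
          ∫ ω, predCoef P 𝒜 (simpleProc (DisjColl.single (o, u) hou) fun _ => F.indicator 1) p ω *
            incr P 𝒜 X p ω ∂P := by
      rw [← funext (meanInt_predCoef h.integrable_A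
        (fun p hp => incr_ae_eq_of_decomp hX hXi h.integrable_M h.integrable_A h.adapted
          h.decomp hp) hC0 hC), ← h.natural _ _ hg, ← integral_indicator_one_mul hF]
      refine integral_congr_ae ((h.zero o ho).mono fun ω hω => ?_)
      simp [DisjColl.single, hω]
    rw [h_mean hA, h_mean hB]
  refine ⟨?_, h_process⟩
  let e : U := ⟨_, h𝒜.empty_mem⟩
  -- The empty set is the largest index, so its σ-algebra is the whole one and the decomposition
  -- there determines `M` from the process.
  have h_top : mΩ ≤ 𝒜 e :=
    h𝒜.generates.le.trans (iSup_le fun u => 𝒜.mono (le_iff_subset.2 (Set.empty_subset _)))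
  refine hA.integrable_M.ae_eq_of_forall_setIntegral_eq _ _ hB.integrable_M fun F hF _ => ?_
  have h1 := hA.decomp e F (h_top F hF)
  have h2 := hB.decomp e F (h_top F hF)
  rw [integral_sub hA.integrable_M.integrableOn (hA.integrable_A e).integrableOn] at h1
  rw [integral_sub hB.integrable_M.integrableOn (hB.integrable_A e).integrableOn] at h2
  have h3 : ∫ ω in F, A e ω ∂P = ∫ ω in F, B e ω ∂P :=
    integral_congr_ae (ae_restrict_of_ae (h_process e))
  linarith

end SetIndexed

open SetIndexed in
theorem corollary1 {Ω I : Type*} [mΩ : MeasurableSpace Ω] (P : Measure Ω) [IsProbabilityMeasure P]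
    (U : Sublattice (Set (Ω × I))ᵒᵈ) (𝒜 : Filtration U mΩ) (h𝒜 : IsIndexedFiltration U 𝒜)
    (L : (DisjColl U → ℝ) → ℝ) (hL : IsBanachLimit L)
    (X : U → Ω → ℝ) (hX : IsPosStrongSupermartingale P 𝒜 X) :
    (IsUIVariation P 𝒜 X ↔
      ∃ (M : Ω → ℝ) (A : U → Ω → ℝ), IsDoobMeyer P 𝒜 L X M A ∧ IsUIVariation P 𝒜 A) ∧
    ∀ (M N : Ω → ℝ) (A B : U → Ω → ℝ), IsDoobMeyer P 𝒜 L X M A → IsDoobMeyer P 𝒜 L X N B →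
      M =ᵐ[P] N ∧ ∀ u, A u =ᵐ[P] B u := by
  have hX_adapted := hX.supermartingale.1
  have hXi := hX.supermartingale.2.2
  have h_iff {M : Ω → ℝ} {A : U → Ω → ℝ} (h : IsDoobMeyer P 𝒜 L X M A) :
      IsUIVariation P 𝒜 X ↔ IsUIVariation P 𝒜 A :=
    isUIVariation_iff_of_incr_ae_eq fun p hp => incr_ae_eq_of_decomp hX_adapted hXi
      h.integrable_M h.integrable_A h.adapted h.decomp hp
  refine ⟨⟨fun hUI => ?_, fun ⟨M, A, h, hA⟩ => (h_iff h).2 hA⟩,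
    fun M N A B hA hB => hA.ae_eq h𝒜 hX_adapted hXi hB⟩
  have h := isDoobMeyer_compensator h𝒜 hL hUI hX (v := ⟨_, h𝒜.empty_mem⟩) rfl
  exact ⟨_, _, h, (h_iff h).1 hUI⟩
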